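/- Fix an odd integer $k\ge 3$. For $n\ge 1$, a unit vector $v_0\in\mathbb R^n$ and $\tau\in\mathbb R$, let $\mathbf T=\tau\, v_0^{\otimes k}+\mathbf A\in(\mathbb R^n)^{\otimes k}$, where the noise $\mathbf A$ is either (a) *asymmetric*: all $n^k$ entries of $\mathbf A$ are independent standard Gaussians; or (b) *symmetric*: $\mathbf A_{\alpha}=\mathbf A_{\pi(\alpha)}$ for every permutation $\pi$ of the $k$ indices, and the entries are otherwise independent standard Gaussians. Algorithms are programs for a randomized real RAM: exact real arithmetic ($+,-,\times,/,\sqrt{\cdot}$, comparison), natural-number registers used for counting and addressing, arrays of reals, and fresh independent standard Gaussian samples (independent of $\mathbf A$), each operation at unit cost. The program may depend on $k$ and on the noise model, but not on $n,v_0,\tau,\epsilon$. Its input is $n$ and the $n^k$ entries of $\mathbf T$. It is *nearly linear time* if for some constants $C',c$ it performs at most $C'\,n^k(1+\log n)^c$ steps for all $n\ge 1$, all input tensors and all values of the random samples. **Theorem.** For each of the noise models (a) and (b) there are a nearly-linear-time program and a constant $C>0$, depending only on $k$, such that for all $n\ge 1$, all unit vectors $v_0\in\mathbb R^n$, all $\epsilon>0$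 and all $$\tau\ \ge\ C\,\frac{n^{k/4}}{\epsilon},$$ with probability at least $1-C n^{-10}$ over $\mathbf A$ and the random samples, the output $v\in\mathbb R^n$ of the program on input $\mathbf T$ satisfies $$\|v\|=1\quad\text{and}\quad\langle v,v_0\rangle^2\ \ge\ 1-\epsilon .$$ In model (a) the program approximates tensor unfolding, in the following sense. Let $w$ be a vector obtained from $\mathbf T$ by exact tensor unfolding: take a unit top right singular vector $u$ of the unfolding of $\mathbf T$ into an $n^{(k+1)/2}\times n^{(k-1)/2}$ matrix, reshape $u$ into an $n\times n^{(k-3)/2}$ matrix, and let $w$ be a unit top left singular vector of that matrix (for $k=3$, $w=\pm u$). Then in model (a), on the same event of probability at least $1-Cn^{-10}$, every such $w$ also satisfies $\langle w,v_0\rangle^2\ge 1-\epsilon$ and $\langle v,w\rangle^2\ge 1-\epsilon$. -/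

import Mathlib

open MeasureTheory ProbabilityTheory Matrix

namespace TensorPCA

/-! ### Tensors, the spiked model and the two noise distributions -/

/-- Real tensors of order `k` with all dimensions equal to `n`. -/
abbrev Tensor (k n : ℕ) : Type := (Fin k → Fin n) → ℝ

/-- The rank-one tensor `v^{⊗k}`. -/
def tensorPower (k : ℕ) {n : ℕ} (v : Fin n → ℝ) : Tensor k n := fun α => ∏ i, v (α i)

/-- The spiked tensor `τ • v₀^{⊗k} + A`. -/
def spiked {k n : ℕ} (τ : ℝ) (v₀ : Fin n → ℝ) (A : Tensor k n) : Tensor k n :=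
  fun α => τ * tensorPower k v₀ α + A α

/-- The law of a tensor with independent standard Gaussian entries. -/
noncomputable def gaussianNoise (k n : ℕ) : Measure (Tensor k n) :=
  Measure.pi fun _ => gaussianReal 0 1

/-- The unordered multi-index (a multiset of size `k`) underlying a multi-index. -/
def unordered {k n : ℕ} (α : Fin k → Fin n) : Sym (Fin n) k :=
  ⟨Finset.univ.val.map α, by simp⟩

/-- The law of a symmetric Gaussian tensor: one independent standard Gaussian for every unordered
multi-index, so that entries whose indices are permutations of each other are equal and the
entries are otherwise independent and standard Gaussian. -/
noncomputable def symmetricGaussianNoise (k n : ℕ) : Measure (Tensor k n) :=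
  (Measure.pi fun _ : Sym (Fin n) k => gaussianReal 0 1).map fun g α => g (unordered α)

/-! ### Tensor unfolding -/

/-- The unfolding of an order-`k` tensor, `k = p + q`, into an `n^p × n^q` matrix. -/
def unfold {k n p q : ℕ} (h : p + q = k) (T : Tensor k n) :
    Matrix (Fin p → Fin n) (Fin q → Fin n) ℝ :=
  Matrix.of fun α β => T fun i => Fin.append α β (Fin.cast h.symm i)

/-- `u` is a top right singular vector of `M`: a unit vector maximizing `‖M u‖`
(equivalently, a unit top eigenvector of `Mᵀ M`). -/
def IsTopRightSingularVector {ι κ : Type*} [Fintype ι] [Fintype κ] (M : Matrix ι κ ℝ)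
    (u : κ → ℝ) : Prop :=
  u ⬝ᵥ u = 1 ∧ ∀ w : κ → ℝ, w ⬝ᵥ w = 1 → (M *ᵥ w) ⬝ᵥ (M *ᵥ w) ≤ (M *ᵥ u) ⬝ᵥ (M *ᵥ u)

/-- `w` is an output of exact tensor unfolding on `T`, a tensor of odd order `k = 2 m + 3`:
take a top right singular vector `u` of the squarest unfolding of `T`, which has dimensions
`n^{(k+1)/2} × n^{(k-1)/2}`; reshape `u` into an `n × n^{(k-3)/2}` matrix; return a top left
singular vector of that matrix. For `k = 3` this just returns `u` up to sign. -/
def IsUnfoldingOutput {k n : ℕ} (T : Tensor k n) (w : Fin n → ℝ) : Prop :=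
  ∃ (m : ℕ) (h : (m + 2) + (m + 1) = k) (u : (Fin (m + 1) → Fin n) → ℝ),
    IsTopRightSingularVector (unfold h T) u ∧
      IsTopRightSingularVector
        (Matrix.of fun (i : Fin n) (γ : Fin m → Fin n) => u (Fin.cons i γ : Fin (m + 1) → Fin n))ᵀ w

/-! ### A randomized real RAM with unit costs -/

/-- Programs of a randomized real RAM. There are registers for natural numbers, registers for
real numbers, and arrays of real numbers with dynamically indexed cells. Operands are static
names of registers and arrays. Real arithmetic is exact; reals cannot be converted to natural
numbers. All loops are counted loops, so that every program terminates. -/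
inductive Program : Type
  /-- natural register `d` receives the constant `c` -/
  | setNat (d c : ℕ)
  /-- natural register `d` receives the sum of `a` and `b` -/
  | addNat (d a b : ℕ)
  /-- natural register `d` receives the truncated difference of `a` and `b` -/
  | subNat (d a b : ℕ)
  /-- natural register `d` receives the product of `a` and `b` -/
  | mulNat (d a b : ℕ)
  /-- real register `d` receives the constant `c` -/
  | setReal (d c : ℕ)
  /-- real register `d` receives the sum of `a` and `b` -/
  | addReal (d a b : ℕ)
  /-- real register `d` receives the difference of `a` and `b` -/
  | subReal (d a b : ℕ)
  /-- real register `d` receives the product of `a` and `b` -/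
  | mulReal (d a b : ℕ)
  /-- real register `d` receives the quotient of `a` and `b` (zero if `b` is zero) -/
  | divReal (d a b : ℕ)
  /-- real register `d` receives the square root of `a` (zero if `a` is negative) -/
  | sqrtReal (d a : ℕ)
  /-- real register `d` receives a fresh standard Gaussian sample -/
  | sample (d : ℕ)
  /-- real register `d` receives the cell of array `a` indexed by natural register `i` -/
  | load (d a i : ℕ)
  /-- the cell of array `a` indexed by natural register `i` receives real register `r` -/
  | store (a i r : ℕ)
  /-- sequential composition -/
  | seq (P Q : Program)
  /-- run `P` if natural register `a` is less than natural register `b`, else run `Q` -/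
  | ifNat (a b : ℕ) (P Q : Program)
  /-- run `P` if real register `a` is less than real register `b`, else run `Q` -/
  | ifReal (a b : ℕ) (P Q : Program)
  /-- run `P` as many times as the value, at the start of the loop, of natural register `a` -/
  | loop (a : ℕ) (P : Program)

/-- The configuration of the machine, with the number of elapsed steps. -/
structure State where
  nat : ℕ → ℕ
  real : ℕ → ℝ
  arr : ℕ → ℕ → ℝ
  /-- the number of random samples drawn so far -/
  drawn : ℕ
  /-- the number of steps executed so far -/
  steps : ℕ

/-- One step elapses. -/
def State.tick (s : State) : State := { s with steps := s.steps + 1 }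

/-- Write `x` to natural register `d`, in one step. -/
def State.putNat (s : State) (d x : ℕ) : State :=
  { s with nat := Function.update s.nat d x, steps := s.steps + 1 }

/-- Write `x` to real register `d`, in one step. -/
noncomputable def State.putReal (s : State) (d : ℕ) (x : ℝ) : State :=
  { s with real := Function.update s.real d x, steps := s.steps + 1 }

/-- Execution of a program. `ω` is the stream of random samples. Every primitive instruction,
every test and every loop iteration (in addition to its body) costs one step. -/
noncomputable def Program.run (ω : ℕ → ℝ) : Program → State → State
  | .setNat d c, s => s.putNat d c
  | .addNat d a b, s => s.putNat d (s.nat a + s.nat b)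
  | .subNat d a b, s => s.putNat d (s.nat a - s.nat b)
  | .mulNat d a b, s => s.putNat d (s.nat a * s.nat b)
  | .setReal d c, s => s.putReal d (c : ℝ)
  | .addReal d a b, s => s.putReal d (s.real a + s.real b)
  | .subReal d a b, s => s.putReal d (s.real a - s.real b)
  | .mulReal d a b, s => s.putReal d (s.real a * s.real b)
  | .divReal d a b, s => s.putReal d (s.real a / s.real b)
  | .sqrtReal d a, s => s.putReal d (Real.sqrt (s.real a))
  | .sample d, s => { s.putReal d (ω s.drawn) with drawn := s.drawn + 1 }
  | .load d a i, s => s.putReal d (s.arr a (s.nat i))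
  | .store a i r, s =>
      { s with
        arr := Function.update s.arr a (Function.update (s.arr a) (s.nat i) (s.real r))
        steps := s.steps + 1 }
  | .seq P Q, s => Q.run ω (P.run ω s)
  | .ifNat a b P Q, s => if s.nat a < s.nat b then P.run ω s.tick else Q.run ω s.tick
  | .ifReal a b P Q, s => if s.real a < s.real b then P.run ω s.tick else Q.run ω s.tick
  | .loop a P, s => (fun s' : State => P.run ω s'.tick)^[s.nat a] s.tick

/-- The initial state on input `T`: natural register `0` holds `n`, array `0` holds the `n ^ k`
entries of `T`, the entry with multi-index `α` in cell `∑ i, α i * n ^ i`; all else is zero. -/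
noncomputable def inputState {k n : ℕ} (T : Tensor k n) : State where
  nat := Function.update (fun _ => 0) 0 n
  real := fun _ => 0
  arr := Function.update (fun _ _ => 0) 0
    fun j => if h : j < n ^ k then T (finFunctionFinEquiv.symm ⟨j, h⟩) else 0
  drawn := 0
  steps := 0

/-- The output vector of a program: the first `n` cells of array `1` on termination. -/
noncomputable def Program.output (P : Program) {k n : ℕ} (T : Tensor k n) (ω : ℕ → ℝ) :
    Fin n → ℝ :=
  fun i => (P.run ω (inputState T)).arr 1 i

/-- The running time of a program: the number of steps executed until termination. -/
noncomputable def Program.time (P : Program) {k n : ℕ} (T : Tensor k n) (ω : ℕ → ℝ) : ℕ :=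
  (P.run ω (inputState T)).steps

/-- On order-`k` tensors, `P` runs in time nearly linear in the input size `n ^ k`, that is
in time `O(n ^ k * polylog n)`, for all inputs and all random samples. -/
def Program.NearlyLinearTime (P : Program) (k : ℕ) : Prop :=
  ∃ (C : ℝ) (c : ℕ), ∀ (n : ℕ), 1 ≤ n → ∀ (T : Tensor k n) (ω : ℕ → ℝ),
    (P.time T ω : ℝ) ≤ C * (n : ℝ) ^ k * (1 + Real.log n) ^ c

/-- The law of the stream of random samples: independent standard Gaussians. -/
noncomputable def sampleLaw : Measure (ℕ → ℝ) :=
  Measure.infinitePi fun _ => gaussianReal 0 1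

/-- `v` recovers the unit vector `v₀`, up to sign, with error `ε`: it is a unit vector with
`⟨v, v₀⟩² ≥ 1 - ε`. -/
def Recovers {n : ℕ} (ε : ℝ) (v₀ v : Fin n → ℝ) : Prop :=
  v ⬝ᵥ v = 1 ∧ 1 - ε ≤ (v ⬝ᵥ v₀) ^ 2

end TensorPCA

open TensorPCA

namespace TensorPCA

/-! One program serves both models. Unfold `T` into an N × n matrix M with N = n^(k-1), columns
indexed by the first tensor index, and run power iteration with the recentred Gram matrix G = MᵀM −
N·1.

For an N × d unfolding with M = τ a bᵀ + A, where a and b are unit tensor powers of v₀, the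
recentred Gram matrix is τ² b bᵀ + τ (b rᵀ + r bᵀ) + (AᵀA − N·1) with r = Aᵀa. With high probability
r has norm O(√d) and the last term has norm O(√(N d)). Here N d = n^k for every unfolding, so if d ≤
N and τ ≥ C n^(k/4)/ε, then G is τ² b bᵀ up to a relative error δ = ε/1000 (`isSpiked_centredGram`,
`noise_le_signal`). Recentring is what makes the thin shape as good as the squarest one: it removes
the diagonal N·1, which could swamp τ². The thin shape has b = v₀, and a product with G costs
O(n^k).

The noise bound (`measure_not_nearlyIsotropic_le`) needs two facts: no Gaussian occurs twice in a
row of A, so AᵀA has mean N·1, and each Gaussian occurs at most K times in all. They hold with K = 1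
for asymmetric noise and with K = k^k for symmetric noise. For a fixed y, Chernoff bounds control
‖Ay‖²; an averaging argument over a ball makes this uniform in y.

On the complement of the top eigenvector u of G, the operator is at most half as strong as on u.
Logarithmically many steps therefore reach constant correlation with v₀ unless the Gaussian start is
atypically orthogonal to u (`IsSpiked.exists_power_iteration`). One further step gives error O(δ),
because G itself is nearly of rank one (`IsSpiked.apply_close`). Hence the number of steps does not
depend on ε.

Exact unfolding is treated by the same spectral estimate for the squarest shape: adding a multiple
of the identity does not move the singular vectors. Reshaping costs another O(δ) (`reshape_close`),
and two vectors close to v₀ up to sign are close to each other up to sign. -/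

/-! ### Exponential moments of the square of a Gaussian -/

lemma inv_sqrt_one_sub_le_exp {x : ℝ} (h1 : -(1 / 2) ≤ x) (h2 : x ≤ 1 / 2) :
    (√(1 - x))⁻¹ ≤ Real.exp ((x + x ^ 2) / 2) := by
  -- This is the squared inequality. Since (1 − x)(1 + x + x²) = 1 − x³, the linear bound on exp
  -- suffices for x ≤ 0, but for x ≥ 0 the quadratic term is needed.
  have key : 1 ≤ (1 - x) * Real.exp (x + x ^ 2) := by
    rcases le_total 0 x with hx | hx
    · have h := Real.quadratic_le_exp_of_nonneg (show 0 ≤ x + x ^ 2 by positivity)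
      have : 1 ≤ (1 - x) * (1 + (x + x ^ 2) + (x + x ^ 2) ^ 2 / 2) := by
        have h3 : x ^ 3 ≤ x ^ 2 / 2 := by nlinarith [sq_nonneg x]
        have h4 : x ^ 4 ≤ x ^ 2 / 4 := by nlinarith [sq_nonneg x]
        have h5 : x ^ 5 ≤ x ^ 2 / 8 := by nlinarith [sq_nonneg x]
        nlinarith
      nlinarith
    · have h := Real.add_one_le_exp (x + x ^ 2)
      have : x ^ 3 ≤ 0 := by nlinarith [sq_nonneg x]
      nlinarith
  have h0 : 0 < 1 - x := by linarith
  have he : Real.exp ((x + x ^ 2) / 2) = √(Real.exp (x + x ^ 2)) := by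
    rw [eq_comm, Real.sqrt_eq_iff_mul_self_eq (Real.exp_pos _).le (Real.exp_pos _).le,
      ← Real.exp_add]
    congr 1; ring
  rw [he, ← Real.sqrt_inv]
  apply Real.sqrt_le_sqrt
  rw [inv_le_iff_one_le_mul₀ h0]
  linarith

lemma exp_sq_gaussianPDFReal (s x : ℝ) :
    gaussianPDFReal 0 1 x * Real.exp (s * x ^ 2) =
      (√(2 * Real.pi))⁻¹ * Real.exp (-(1 / 2 - s) * x ^ 2) := by
  rw [gaussianPDFReal, mul_assoc, ← Real.exp_add]
  simp only [NNReal.coe_one, mul_one, sub_zero]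
  congr 2; ring

lemma integrable_exp_mul_sq_gaussianReal {s : ℝ} (hs : s < 1 / 2) :
    Integrable (fun x => Real.exp (s * x ^ 2)) (gaussianReal 0 1) := by
  rw [gaussianReal_of_var_ne_zero _ one_ne_zero]
  rw [integrable_withDensity_iff (measurable_gaussianPDF _ _)
    (Filter.Eventually.of_forall fun x => by simp [gaussianPDF])]
  refine ((integrable_exp_neg_mul_sq (b := 1 / 2 - s) (by linarith)).const_mul
    (√(2 * Real.pi))⁻¹).congr (Filter.Eventually.of_forall fun x => ?_)
  simp only [toReal_gaussianPDF]
  rw [← exp_sq_gaussianPDFReal, mul_comm]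

/-- The integral equals (1 − 2s)^(-1/2), and the preceding estimate applies with x = 2s. -/
lemma integral_exp_mul_sq_gaussianReal_le {s : ℝ} (h1 : -(1 / 4) ≤ s) (h2 : s ≤ 1 / 4) :
    ∫ x, Real.exp (s * x ^ 2) ∂(gaussianReal 0 1) ≤ Real.exp (s + 2 * s ^ 2) := by
  rw [integral_gaussianReal_eq_integral_smul one_ne_zero]
  simp only [smul_eq_mul, exp_sq_gaussianPDFReal]
  rw [integral_const_mul, integral_gaussian, ← Real.sqrt_inv, ← Real.sqrt_mul (by positivity)]
  have h3 : (0 : ℝ) < 1 - 2 * s := by linarith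
  have : (2 * Real.pi)⁻¹ * (Real.pi / (1 / 2 - s)) = (1 - 2 * s)⁻¹ := by
    have : (1 / 2 - s) = (1 - 2 * s) / 2 := by ring
    rw [this]
    field_simp
  rw [this, Real.sqrt_inv]
  refine (inv_sqrt_one_sub_le_exp (by linarith) (by linarith)).trans_eq ?_
  congr 1; ring

/-! ### Concentration of Gaussian quadratic forms -/

section Quadratic

variable {V : Type*} [NormedAddCommGroup V] [InnerProductSpace ℝ V] [FiniteDimensional ℝ V]
  [MeasurableSpace V] [BorelSpace V]

/-- The exponential moments of a positive semidefinite quadratic form in a standard Gaussian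
vector. -/
lemma integral_exp_quadratic_stdGaussian_le {T : V →ₗ[ℝ] V} (hT : T.IsSymmetric) {K : ℝ}
    (h0 : ∀ x, 0 ≤ inner ℝ (T x) x) (hK : ∀ x, inner ℝ (T x) x ≤ K * ‖x‖ ^ 2)
    {l : ℝ} (hl : |l| * K ≤ 1 / 4) :
    Integrable (fun x => Real.exp (l * inner ℝ (T x) x)) (stdGaussian V) ∧
    ∫ x, Real.exp (l * inner ℝ (T x) x) ∂(stdGaussian V) ≤
      Real.exp ((l + 2 * l ^ 2 * K) * LinearMap.trace ℝ V T) := by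
  -- Coordinates in an eigenbasis are again independent standard Gaussians, so the form becomes a
  -- weighted sum of independent squares and the exponential moment factors.
  set b := hT.eigenvectorBasis rfl
  set d := hT.eigenvalues rfl
  have hTb : ∀ i, T (b i) = d i • b i := fun i => hT.apply_eigenvectorBasis rfl i
  have hd : ∀ i, inner ℝ (T (b i)) (b i) = d i := fun i => by
    rw [hTb, inner_smul_left]; simp
  have hd0 : ∀ i, 0 ≤ d i := fun i => hd i ▸ h0 (b i)
  have hdK : ∀ i, d i ≤ K := fun i => by simpa [hd] using hK (b i)
  have hq : ∀ y : Fin (Module.finrank ℝ V) → ℝ,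
      inner ℝ (T (∑ i, y i • b i)) (∑ i, y i • b i) = ∑ i, d i * y i ^ 2 := fun y => by
    have : T (∑ i, y i • b i) = ∑ i, (y i * d i) • b i := by
      simp [map_sum, hTb, mul_smul]
    rw [this, b.orthonormal.inner_sum]
    exact Finset.sum_congr rfl fun i _ => by simp; ring
  have hmeas : Measurable fun y : Fin (Module.finrank ℝ V) → ℝ => ∑ i, y i • b i := by fun_prop
  have hcont : Continuous fun x : V => Real.exp (l * inner ℝ (T x) x) := by
    have := T.continuous_of_finiteDimensional
    fun_prop
  have hprod : ∀ y : Fin (Module.finrank ℝ V) → ℝ,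
      Real.exp (l * inner ℝ (T (∑ i, y i • b i)) (∑ i, y i • b i)) =
        ∏ i, Real.exp ((l * d i) * y i ^ 2) := fun y => by
    rw [hq, Finset.mul_sum, Real.exp_sum]
    simp only [mul_assoc]
  have hld : ∀ i, |l * d i| ≤ 1 / 4 := fun i => by
    rw [abs_mul, abs_of_nonneg (hd0 i)]
    exact (mul_le_mul_of_nonneg_left (hdK i) (abs_nonneg _)).trans hl
  rw [stdGaussian_eq_map_pi_orthonormalBasis b]
  constructor
  · rw [integrable_map_measure hcont.aestronglyMeasurable hmeas.aemeasurable]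
    simp only [Function.comp_def, hprod]
    exact Integrable.fintype_prod (f := fun i x => Real.exp (l * d i * x ^ 2)) fun i =>
      integrable_exp_mul_sq_gaussianReal (by linarith [(abs_le.1 (hld i)).2])
  · rw [integral_map hmeas.aemeasurable hcont.aestronglyMeasurable]
    simp only [hprod]
    rw [integral_fintype_prod_eq_prod (f := fun i x => Real.exp (l * d i * x ^ 2))]
    have htr : LinearMap.trace ℝ V T = ∑ i, d i := by
      simpa using hT.trace_eq_sum_eigenvalues rfl
    rw [htr, Finset.mul_sum, Real.exp_sum]
    refine Finset.prod_le_prod (fun i _ => integral_nonneg fun x => (Real.exp_pos _).le)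
      fun i _ => (integral_exp_mul_sq_gaussianReal_le (abs_le.1 (hld i)).1
        (abs_le.1 (hld i)).2).trans ?_
    rw [Real.exp_le_exp]
    -- Replaces the sum of squared eigenvalues by K times the trace.
    have : d i ^ 2 ≤ K * d i := by nlinarith [hd0 i, hdK i]
    nlinarith [sq_nonneg l]

variable {W : Type*} [NormedAddCommGroup W] [InnerProductSpace ℝ W] [FiniteDimensional ℝ W]

/-- The exponential moments of the squared norm of a linear image of a standard Gaussian
vector. -/
lemma integral_exp_normSq_stdGaussian_le {ι : Type*} [Fintype ι] (L : V →ₗ[ℝ] W) {K : ℝ}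
    (b : OrthonormalBasis ι ℝ V) (hK : ∀ x, ‖L x‖ ^ 2 ≤ K * ‖x‖ ^ 2)
    {l : ℝ} (hl : |l| * K ≤ 1 / 4) :
    Integrable (fun x => Real.exp (l * ‖L x‖ ^ 2)) (stdGaussian V) ∧
    ∫ x, Real.exp (l * ‖L x‖ ^ 2) ∂(stdGaussian V) ≤
      Real.exp ((l + 2 * l ^ 2 * K) * ∑ i, ‖L (b i)‖ ^ 2) := by
  have hin : ∀ x, inner ℝ ((L.adjoint ∘ₗ L) x) x = ‖L x‖ ^ 2 := fun x => by
    rw [LinearMap.comp_apply, LinearMap.adjoint_inner_left, real_inner_self_eq_norm_sq]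
  have h := integral_exp_quadratic_stdGaussian_le (T := L.adjoint ∘ₗ L) (K := K) (l := l)
    (fun x y => by
      simp only [LinearMap.comp_apply, LinearMap.adjoint_inner_left, LinearMap.adjoint_inner_right])
    (fun x => by rw [hin]; positivity) (fun x => by rw [hin]; exact hK x) hl
  have htr : LinearMap.trace ℝ V (L.adjoint ∘ₗ L) = ∑ i, ‖L (b i)‖ ^ 2 := by
    rw [LinearMap.trace_eq_sum_inner _ b]
    exact Finset.sum_congr rfl fun i _ => by rw [real_inner_comm, hin]
  simpa only [hin, htr] using h

/-- Chernoff's bound around the mean of ‖L x‖², which is the trace ∑ ‖L (b i)‖². The parameter `l`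
stays free because different applications choose it differently. -/
lemma stdGaussian_normSq_ge_le {ι : Type*} [Fintype ι] (L : V →ₗ[ℝ] W) {K : ℝ}
    (b : OrthonormalBasis ι ℝ V) (hK : ∀ x, ‖L x‖ ^ 2 ≤ K * ‖x‖ ^ 2)
    {l : ℝ} (hl0 : 0 ≤ l) (hl : l * K ≤ 1 / 4) (s : ℝ) :
    (stdGaussian V).real {x | ∑ i, ‖L (b i)‖ ^ 2 + s ≤ ‖L x‖ ^ 2} ≤
      Real.exp (-l * s + 2 * l ^ 2 * K * ∑ i, ‖L (b i)‖ ^ 2) := by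
  obtain ⟨h1, h2⟩ := integral_exp_normSq_stdGaussian_le L b hK (l := l) (by rwa [abs_of_nonneg hl0])
  refine (measure_ge_le_exp_mul_mgf _ hl0 h1).trans ?_
  refine (mul_le_mul_of_nonneg_left h2 (Real.exp_pos _).le).trans_eq ?_
  rw [← Real.exp_add]; congr 1; ring

lemma stdGaussian_normSq_le_le {ι : Type*} [Fintype ι] (L : V →ₗ[ℝ] W) {K : ℝ}
    (b : OrthonormalBasis ι ℝ V) (hK : ∀ x, ‖L x‖ ^ 2 ≤ K * ‖x‖ ^ 2)
    {l : ℝ} (hl0 : 0 ≤ l) (hl : l * K ≤ 1 / 4) (s : ℝ) :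
    (stdGaussian V).real {x | ‖L x‖ ^ 2 ≤ ∑ i, ‖L (b i)‖ ^ 2 - s} ≤
      Real.exp (-l * s + 2 * l ^ 2 * K * ∑ i, ‖L (b i)‖ ^ 2) := by
  obtain ⟨h1, h2⟩ := integral_exp_normSq_stdGaussian_le L b hK (l := -l)
    (by rwa [abs_neg, abs_of_nonneg hl0])
  refine (measure_le_le_exp_mul_mgf _ (neg_nonpos.2 hl0) h1).trans ?_
  refine (mul_le_mul_of_nonneg_left h2 (Real.exp_pos _).le).trans_eq ?_
  rw [← Real.exp_add]; congr 1; ring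

/-- The density is at most 1/2 and the interval has length 2t. -/
lemma gaussianReal_abs_lt_le (t : ℝ) :
    gaussianReal 0 1 {x : ℝ | |x| < t} ≤ ENNReal.ofReal t := by
  rw [gaussianReal_apply _ one_ne_zero]
  have hs : {x : ℝ | |x| < t} = Set.Ioo (-t) t := by ext x; simp [abs_lt]
  rw [hs]
  calc ∫⁻ x in Set.Ioo (-t) t, gaussianPDF 0 1 x
      ≤ ∫⁻ x in Set.Ioo (-t) t, ENNReal.ofReal (1 / 2) := by
        refine lintegral_mono fun x => ENNReal.ofReal_le_ofReal ?_
        rw [gaussianPDFReal]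
        have h2 : (2 : ℝ) ≤ √(2 * Real.pi * (1 : NNReal)) :=
          Real.le_sqrt_of_sq_le (by norm_num; linarith [Real.pi_gt_three])
        have h1 : Real.exp (-(x - 0) ^ 2 / (2 * (1 : NNReal))) ≤ 1 :=
          Real.exp_le_one_iff.2 (by
            have : 0 ≤ (x - 0) ^ 2 := sq_nonneg _
            norm_num at this ⊢; linarith)
        calc _ ≤ (2 : ℝ)⁻¹ * 1 := by gcongr
          _ = 1 / 2 := by norm_num
    _ = ENNReal.ofReal t := by
        rw [setLIntegral_const, Real.volume_Ioo, ← ENNReal.ofReal_mul (by norm_num)]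
        congr 1; ring

lemma stdGaussian_abs_inner_lt_le {u : V} (hu : ‖u‖ = 1) (t : ℝ) :
    stdGaussian V {x | |inner ℝ u x| < t} ≤ ENNReal.ofReal t := by
  have h := IsGaussian.map_eq_gaussianReal (μ := stdGaussian V) (innerSL ℝ u)
  rw [integral_strongDual_stdGaussian, variance_dual_stdGaussian, innerSL_apply_norm, hu] at h
  have hm : Measurable (innerSL ℝ u) := (innerSL ℝ u).continuous.measurable
  have hs : MeasurableSet {x : ℝ | |x| < t} := measurableSet_lt (by fun_prop) (by fun_prop)
  have := Measure.map_apply (μ := stdGaussian V) hm hs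
  rw [h] at this
  simp only [one_pow, Real.toNNReal_one] at this
  calc _ = _ := this.symm
    _ ≤ _ := gaussianReal_abs_lt_le t

end Quadratic

/-! ### From pointwise to uniform bounds on random quadratic forms -/

section Averaging

variable {V : Type*} [NormedAddCommGroup V] [InnerProductSpace ℝ V]

/-- A bound on a symmetric quadratic form bounds the associated bilinear form. -/
lemma abs_inner_le_of_quadratic_le {Q : V →ₗ[ℝ] V} (hQ : Q.IsSymmetric) {S : ℝ}
    (h : ∀ x, |inner ℝ (Q x) x| ≤ S * ‖x‖ ^ 2) (x y : V) :
    |inner ℝ (Q x) y| ≤ S * (‖x‖ * ‖y‖) := by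
  -- Polarization and the parallelogram law give the arithmetic mean of the squared norms; rescaling
  -- x and y separately to unit length then gives the product.
  have key : ∀ x y : V, |inner ℝ (Q x) y| ≤ S * ((‖x‖ ^ 2 + ‖y‖ ^ 2) / 2) := fun x y => by
    have h1 := h (x + y)
    have h2 := h (x - y)
    have hpar := parallelogram_law_with_norm ℝ x y
    have hs : inner ℝ (Q y) x = inner ℝ (Q x) y := by rw [hQ y x, real_inner_comm]
    have e : 4 * inner ℝ (Q x) y =
        inner ℝ (Q (x + y)) (x + y) - inner ℝ (Q (x - y)) (x - y) := by
      simp only [map_add, map_sub, inner_add_left, inner_add_right, inner_sub_left,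
        inner_sub_right, hs]
      ring
    have : S * (‖x + y‖ ^ 2 + ‖x - y‖ ^ 2) = S * (2 * (‖x‖ ^ 2 + ‖y‖ ^ 2)) := by
      congr 1
    rw [abs_le] at *
    constructor <;> nlinarith
  rcases eq_or_ne x 0 with rfl | hx
  · simp
  rcases eq_or_ne y 0 with rfl | hy
  · simp
  have hx' : 0 < ‖x‖ := norm_pos_iff.2 hx
  have hy' : 0 < ‖y‖ := norm_pos_iff.2 hy
  have := key (‖x‖⁻¹ • x) (‖y‖⁻¹ • y)
  rw [map_smul, inner_smul_left, inner_smul_right, norm_smul, norm_smul, norm_inv, norm_inv,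
    norm_norm, norm_norm, inv_mul_cancel₀ hx'.ne', inv_mul_cancel₀ hy'.ne', abs_mul, abs_mul] at this
  simp only [conj_trivial, abs_inv, abs_norm] at this
  norm_num at this
  rw [inv_mul_le_iff₀ hx', inv_mul_le_iff₀ hy'] at this
  linarith

/-- The difference of the two values is ⟨Q(y − x), y + x⟩, which is at most S · (1/4) · (9/4) =
(9/16) S. So a large maximum is large on a whole ball, and volume can replace a net. -/
lemma quadratic_ge_near_maximizer {Q : V →ₗ[ℝ] V} (hQ : Q.IsSymmetric) {x : V} (hx : ‖x‖ = 1)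
    (hmax : ∀ y, ‖y‖ = 1 → |inner ℝ (Q y) y| ≤ |inner ℝ (Q x) x|) {y : V} (hy : ‖y - x‖ ≤ 1 / 4) :
    7 / 16 * |inner ℝ (Q x) x| ≤ |inner ℝ (Q y) y| := by
  set S := |inner ℝ (Q x) x| with hS
  have hS0 : 0 ≤ S := abs_nonneg _
  have h : ∀ z, |inner ℝ (Q z) z| ≤ S * ‖z‖ ^ 2 := fun z => by
    rcases eq_or_ne z 0 with rfl | hz
    · simp
    have hz' : 0 < ‖z‖ := norm_pos_iff.2 hz
    have := hmax (‖z‖⁻¹ • z) (by rw [norm_smul, norm_inv, norm_norm, inv_mul_cancel₀ hz'.ne'])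
    rw [map_smul, inner_smul_left, inner_smul_right, abs_mul, abs_mul] at this
    simp only [conj_trivial, abs_inv, abs_norm] at this
    rw [inv_mul_le_iff₀ hz', inv_mul_le_iff₀ hz'] at this
    nlinarith
  have h1 := abs_inner_le_of_quadratic_le hQ h (y - x) (y + x)
  have hyx : ‖y + x‖ ≤ 9 / 4 := by
    have : y + x = (y - x) + (2 : ℝ) • x := by rw [two_smul]; abel
    rw [this]
    refine (norm_add_le _ _).trans ?_
    rw [norm_smul, hx]; norm_num; linarith
  have e : inner ℝ (Q (y - x)) (y + x) = inner ℝ (Q y) y - inner ℝ (Q x) x := by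
    have hs : inner ℝ (Q y) x = inner ℝ (Q x) y := by rw [hQ y x, real_inner_comm]
    simp only [map_sub, inner_sub_left, inner_add_right, hs]; ring
  have h2 : S * (‖y - x‖ * ‖y + x‖) ≤ S * (1 / 4 * (9 / 4)) := by gcongr
  rw [e] at h1
  have h3 := abs_sub_abs_le_abs_sub (inner ℝ (Q x) x) (inner ℝ (Q y) y)
  rw [abs_sub_comm] at h3
  linarith

variable [FiniteDimensional ℝ V] [MeasurableSpace V] [BorelSpace V] [Nontrivial V]

/-- A uniform tail bound for a random quadratic form from a pointwise one. -/
lemma measure_exists_quadratic_ge_le {Ω : Type*} [MeasurableSpace Ω] (μ : Measure Ω) [SFinite μ]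
    (Q : Ω → V →ₗ[ℝ] V) (hQ : ∀ ω, (Q ω).IsSymmetric)
    (hm : Measurable fun p : Ω × V => inner ℝ (Q p.1 p.2) p.2) {t : ℝ} (ht : 0 < t) {p : ENNReal}
    (hp : ∀ y, ‖y‖ = 1 → μ {ω | 7 / 25 * t ≤ |inner ℝ (Q ω y) y|} ≤ p) :
    μ {ω | ∃ y, ‖y‖ = 1 ∧ t ≤ |inner ℝ (Q ω y) y|} ≤ 5 ^ Module.finrank ℝ V * p := by
  let vol : Measure V := (volume : Measure V)
  -- A value at least t somewhere on the sphere forces values at least 7t/16 on a ball of radius 1/4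
  -- inside `R`. By Markov and Fubini, the probability of this is at most the pointwise probability
  -- times the volume ratio 5^dim.
  set R : Set V := Metric.ball 0 (5 / 4)
  set D : Set (Ω × V) := {p | 7 / 16 * t ≤ |inner ℝ (Q p.1 p.2) p.2|}
  have hD : MeasurableSet D := measurableSet_le measurable_const hm.abs
  set ν : Measure V := volume.restrict R
  have : IsFiniteMeasure ν := ⟨by simp [ν, R, measure_ball_lt_top]⟩
  set f : Ω → ENNReal := fun ω => ν (Prod.mk ω ⁻¹' D)
  have hf : Measurable f := measurable_measure_prodMk_left hD
  set v : ENNReal := volume (Metric.ball (0 : V) (1 / 4))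
  have hv0 : v ≠ 0 := (Metric.measure_ball_pos _ _ (by norm_num)).ne'
  have hvt : v ≠ ⊤ := measure_ball_lt_top.ne
  have hball : ∀ x : V, volume (Metric.ball x (1 / 4)) = v := fun x =>
    Measure.addHaar_ball_center _ _ _
  have hvR : volume R = 5 ^ Module.finrank ℝ V * v := by
    have := Measure.addHaar_ball_mul (volume : Measure V) (0 : V) (r := 5) (by norm_num) (1 / 4)
    rw [show (5 : ℝ) * (1 / 4) = 5 / 4 by norm_num] at this
    rw [this, ENNReal.ofReal_pow (by norm_num)]
    norm_num [v]
  have hsub : {ω | ∃ y, ‖y‖ = 1 ∧ t ≤ |inner ℝ (Q ω y) y|} ⊆ {ω | v ≤ f ω} := by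
    rintro ω ⟨y, hy, hty⟩
    have hcont : Continuous fun z : V => |inner ℝ (Q ω z) z| := by
      have := (Q ω).continuous_of_finiteDimensional
      fun_prop
    obtain ⟨x, hx, hmax⟩ := (isCompact_sphere (0 : V) 1).exists_isMaxOn
      ⟨y, by simpa using hy⟩ hcont.continuousOn
    have hx1 : ‖x‖ = 1 := by simpa using hx
    have hmax' : ∀ z, ‖z‖ = 1 → |inner ℝ (Q ω z) z| ≤ |inner ℝ (Q ω x) x| := fun z hz =>
      hmax (by simpa using hz)
    show v ≤ f ω
    rw [← hball x]
    have : Metric.ball x (1 / 4) ⊆ (Prod.mk ω ⁻¹' D) ∩ R := by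
      intro z hz
      rw [Metric.mem_ball, dist_eq_norm] at hz
      constructor
      · show 7 / 16 * t ≤ |inner ℝ (Q ω z) z|
        have := quadratic_ge_near_maximizer (hQ ω) hx1 hmax' hz.le
        have := hmax' y hy
        linarith
      · simp only [R, Metric.mem_ball, dist_zero_right]
        have : z = (z - x) + x := by abel
        rw [this]
        exact (norm_add_le _ _).trans_lt (by linarith)
    refine (measure_mono this).trans_eq ?_
    simp only [f, ν]
    rw [Measure.restrict_apply (measurable_prodMk_left hD)]
  have hint : ∫⁻ ω, f ω ∂μ ≤ p * volume R := by
    have e1 : ∫⁻ ω, f ω ∂μ = (μ.prod ν) D := (Measure.prod_apply hD).symm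
    rw [e1, Measure.prod_apply_symm hD]
    calc ∫⁻ y in R, μ ((fun x => (x, y)) ⁻¹' D) ≤ ∫⁻ y in R, p := by
          refine setLIntegral_mono measurable_const fun y hy => ?_
          rcases eq_or_ne y 0 with rfl | hy0
          · have : (fun x : Ω => (x, (0 : V))) ⁻¹' D = ∅ := by
              ext ω; simp [D, ht]
            rw [this]; simp
          have hy' : 0 < ‖y‖ := norm_pos_iff.2 hy0
          have hyR : ‖y‖ < 5 / 4 := by simpa [R] using hy
          -- Rescaling y from norm at most 5/4 to norm 1 changes 7/16 to at least (7/16)(4/5)² =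
          -- 7/25.
          refine (measure_mono ?_).trans (hp (‖y‖⁻¹ • y)
            (by rw [norm_smul, norm_inv, norm_norm, inv_mul_cancel₀ hy'.ne']))
          intro ω (hω : 7 / 16 * t ≤ |inner ℝ (Q ω y) y|)
          show 7 / 25 * t ≤ |inner ℝ (Q ω (‖y‖⁻¹ • y)) (‖y‖⁻¹ • y)|
          rw [map_smul, inner_smul_left, inner_smul_right, abs_mul, abs_mul]
          simp only [conj_trivial, abs_inv, abs_norm]
          rw [le_inv_mul_iff₀ hy', le_inv_mul_iff₀ hy']
          have : ‖y‖ * ‖y‖ ≤ 5 / 4 * (5 / 4) := by gcongr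
          nlinarith
      _ = p * volume R := by rw [setLIntegral_const]
  have h1 := mul_meas_ge_le_lintegral (μ := μ) hf v
  have h2 : v * μ {ω | ∃ y, ‖y‖ = 1 ∧ t ≤ |inner ℝ (Q ω y) y|} ≤
      v * (5 ^ Module.finrank ℝ V * p) :=
    calc _ ≤ v * μ {ω | v ≤ f ω} := by gcongr
      _ ≤ p * volume R := h1.trans hint
      _ = _ := by rw [hvR]; ring
  exact (ENNReal.mul_le_mul_iff_right hv0 hvt).1 h2

end Averaging

/-! ### Near isotropy of Gaussian matrices with repeated entries -/

section Noise

variable {ι ρ κ : Type*} [Fintype ι] [Fintype ρ] [Fintype κ]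

lemma sum_sq_comp_le (cl : ρ → κ → ι) {K : ℕ}
    (hK : ∀ i, Nat.card {p : ρ × κ // cl p.1 p.2 = i} ≤ K) (g : ι → ℝ) :
    ∑ a, ∑ j, g (cl a j) ^ 2 ≤ K * ∑ i, g i ^ 2 := by
  classical
  rw [← Fintype.sum_prod_type', ← Finset.sum_fiberwise_of_maps_to (t := Finset.univ)
    (g := fun p : ρ × κ => cl p.1 p.2) (fun _ _ => Finset.mem_univ _), Finset.mul_sum]
  refine Finset.sum_le_sum fun i _ => ?_
  rw [Finset.sum_congr rfl (g := fun _ => g i ^ 2) (fun p hp => by rw [(Finset.mem_filter.1 hp).2]),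
    Finset.sum_const, nsmul_eq_mul]
  gcongr
  refine le_trans (le_of_eq ?_) (hK i)
  rw [Nat.card_eq_fintype_card, Fintype.card_subtype]

end Noise

section Noise

variable {ι ρ κ : Type*} [Fintype ι] [Fintype ρ] [Fintype κ]

/-- The matrix whose entries are copies of the entries of `g`. -/
def patternMatrix (cl : ρ → κ → ι) (g : ι → ℝ) : Matrix ρ κ ℝ := Matrix.of fun a j => g (cl a j)

/-- The columns of `A` are nearly orthogonal and of equal length, and nearly orthogonal
to `a`. -/
def NearlyIsotropic (A : Matrix ρ κ ℝ) (a : ρ → ℝ) (t c : ℝ) : Prop :=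
  (∀ y, |(A *ᵥ y) ⬝ᵥ (A *ᵥ y) - Fintype.card ρ * (y ⬝ᵥ y)| ≤ t * (y ⬝ᵥ y)) ∧
    (a ᵥ* A) ⬝ᵥ (a ᵥ* A) ≤ c

/-- The linear map `g ↦ patternMatrix cl g *ᵥ y`. -/
noncomputable def patternMulVec (cl : ρ → κ → ι) (y : κ → ℝ) :
    EuclideanSpace ℝ ι →ₗ[ℝ] EuclideanSpace ℝ ρ where
  toFun g := WithLp.toLp 2 (patternMatrix cl g *ᵥ y)
  map_add' g h := by
    ext a
    simp [patternMatrix, Matrix.mulVec, dotProduct, add_mul, Finset.sum_add_distrib]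
  map_smul' r g := by
    ext a
    simp [patternMatrix, Matrix.mulVec, dotProduct, Finset.mul_sum, mul_assoc]

/-- The linear map `g ↦ a ᵥ* patternMatrix cl g`. -/
noncomputable def patternVecMul (cl : ρ → κ → ι) (a : ρ → ℝ) :
    EuclideanSpace ℝ ι →ₗ[ℝ] EuclideanSpace ℝ κ where
  toFun g := WithLp.toLp 2 (a ᵥ* patternMatrix cl g)
  map_add' g h := by
    ext j
    simp [patternMatrix, Matrix.vecMul, dotProduct, mul_add, Finset.sum_add_distrib]
  map_smul' r g := by
    ext j
    simp only [patternMatrix, Matrix.vecMul, dotProduct, PiLp.smul_apply, smul_eq_mul,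
      Matrix.of_apply, RingHom.id_apply, Finset.mul_sum]
    exact Finset.sum_congr rfl fun i _ => by ring

lemma normSq_toLp (x : κ → ℝ) : ‖WithLp.toLp 2 x‖ ^ 2 = x ⬝ᵥ x := by
  rw [EuclideanSpace.real_norm_sq_eq]
  simp [dotProduct, sq]

/-- Cauchy–Schwarz in each row leaves the sum of the squared entries, in which every variable is
counted at most K times. -/
lemma patternMulVec_normSq_le (cl : ρ → κ → ι) {K : ℕ}
    (hK : ∀ i, Nat.card {p : ρ × κ // cl p.1 p.2 = i} ≤ K) {y : κ → ℝ} (hy : y ⬝ᵥ y = 1)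
    (g : EuclideanSpace ℝ ι) : ‖patternMulVec cl y g‖ ^ 2 ≤ K * ‖g‖ ^ 2 := by
  rw [EuclideanSpace.real_norm_sq_eq, EuclideanSpace.real_norm_sq_eq]
  refine le_trans (Finset.sum_le_sum fun a _ => ?_) (sum_sq_comp_le cl hK g)
  have h := Finset.sum_mul_sq_le_sq_mul_sq Finset.univ (fun j => g (cl a j)) y
  have hy' : ∑ j, y j ^ 2 = 1 := by simpa [dotProduct, sq] using hy
  rw [hy', mul_one] at h
  exact h

lemma patternVecMul_normSq_le (cl : ρ → κ → ι) {K : ℕ}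
    (hK : ∀ i, Nat.card {p : ρ × κ // cl p.1 p.2 = i} ≤ K) {a : ρ → ℝ} (ha : a ⬝ᵥ a = 1)
    (g : EuclideanSpace ℝ ι) : ‖patternVecMul cl a g‖ ^ 2 ≤ K * ‖g‖ ^ 2 := by
  rw [EuclideanSpace.real_norm_sq_eq, EuclideanSpace.real_norm_sq_eq]
  refine le_trans (Finset.sum_le_sum fun j _ => ?_)
    ((Finset.sum_comm).trans_le (sum_sq_comp_le cl hK g))
  have h := Finset.sum_mul_sq_le_sq_mul_sq Finset.univ a (fun r => g (cl r j))
  have ha' : ∑ j, a j ^ 2 = 1 := by simpa [dotProduct, sq] using ha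
  rw [ha', one_mul] at h
  exact h

/-- A variable occurs at most once in a row, so each row contributes ∑ y_j² = 1. Thus the mean of
‖Ay‖² is exactly the number of rows, even when variables recur in different rows. -/
lemma sum_normSq_patternMulVec (cl : ρ → κ → ι) (hcl : ∀ a, Function.Injective (cl a))
    {y : κ → ℝ} (hy : y ⬝ᵥ y = 1) :
    ∑ i, ‖patternMulVec cl y (EuclideanSpace.basisFun ι ℝ i)‖ ^ 2 = Fintype.card ρ := by
  classical
  simp only [EuclideanSpace.real_norm_sq_eq]
  rw [Finset.sum_comm]
  have hy' : ∑ j, y j ^ 2 = 1 := by simpa [dotProduct, sq] using hy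
  have : ∀ a : ρ, ∑ i, (patternMulVec cl y (EuclideanSpace.basisFun ι ℝ i) a) ^ 2 = 1 := by
    intro a
    rw [← hy']
    symm
    apply Fintype.sum_of_injective (cl a) (hcl a)
    · intro i hi
      have : ∀ j, cl a j ≠ i := fun j h => hi ⟨j, h⟩
      simp [patternMulVec, patternMatrix, Matrix.mulVec, dotProduct, this]
    · intro j
      have : ∀ i, cl a i = cl a j ↔ i = j := fun i => (hcl a).eq_iff
      simp [patternMulVec, patternMatrix, Matrix.mulVec, dotProduct, this]
  rw [Finset.sum_congr rfl fun a _ => this a]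
  simp

/-- A column may contain the same variable up to K times. Cauchy–Schwarz over these copies costs the
factor K, and an inequality suffices because this quantity is not recentred. -/
lemma sum_normSq_patternVecMul_le (cl : ρ → κ → ι) {K : ℕ}
    (hK : ∀ i, Nat.card {p : ρ × κ // cl p.1 p.2 = i} ≤ K) {a : ρ → ℝ} (ha : a ⬝ᵥ a = 1) :
    ∑ i, ‖patternVecMul cl a (EuclideanSpace.basisFun ι ℝ i)‖ ^ 2 ≤ K * Fintype.card κ := by
  classical
  simp only [EuclideanSpace.real_norm_sq_eq]
  rw [Finset.sum_comm]
  have ha' : ∑ j, a j ^ 2 = 1 := by simpa [dotProduct, sq] using ha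
  have : ∀ j : κ, ∑ i, (patternVecMul cl a (EuclideanSpace.basisFun ι ℝ i) j) ^ 2 ≤ K := by
    intro j
    have e : ∀ i, patternVecMul cl a (EuclideanSpace.basisFun ι ℝ i) j =
        ∑ r with cl r j = i, a r := fun i => by
      simp [patternVecMul, patternMatrix, Matrix.vecMul, dotProduct, Finset.sum_filter]
    calc _ ≤ ∑ i, (K : ℝ) * ∑ r with cl r j = i, a r ^ 2 := by
          refine Finset.sum_le_sum fun i _ => ?_
          rw [e]
          refine sq_sum_le_card_mul_sum_sq.trans ?_
          have hcard : (Finset.univ.filter fun r => cl r j = i).card ≤ K := by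
            refine le_trans ?_ (hK i)
            rw [Nat.card_eq_fintype_card, Fintype.card_subtype]
            exact Finset.card_le_card_of_injOn (fun r => (r, j)) (fun r hr => by simpa using hr)
              fun r _ r' _ h => (Prod.mk.inj h).1
          gcongr
      _ = K := by
          rw [← Finset.mul_sum, Finset.sum_fiberwise _ (fun r => cl r j), ha', mul_one]
  refine (Finset.sum_le_sum fun j _ => this j).trans_eq ?_
  simp [mul_comm]

lemma pi_gaussianReal_apply (s : Set (ι → ℝ)) :
    Measure.pi (fun _ : ι => gaussianReal 0 1) s =
      stdGaussian (EuclideanSpace ℝ ι) {x | x.ofLp ∈ s} := by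
  rw [← map_pi_eq_stdGaussian]
  have := MeasurableEquiv.map_apply (μ := Measure.pi (fun _ : ι => gaussianReal 0 1))
    (MeasurableEquiv.toLp 2 (ι → ℝ)) {x | x.ofLp ∈ s}
  rw [MeasurableEquiv.coe_toLp] at this
  rw [this]
  rfl

lemma norm_toLp_pos {y : κ → ℝ} (hy : y ≠ 0) :
    0 < ‖WithLp.toLp 2 y‖ := norm_pos_iff.2 fun h => hy (by simpa using h)

/-- Gaussian noise is nearly isotropic with high probability. -/
lemma measure_not_nearlyIsotropic_le [Nonempty κ] (cl : ρ → κ → ι)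
    (hcl : ∀ a, Function.Injective (cl a)) {K : ℕ}
    (hK : ∀ i, Nat.card {p : ρ × κ // cl p.1 p.2 = i} ≤ K) (hK1 : 1 ≤ K)
    (hcard : 36 * K ^ 2 * Fintype.card κ ≤ Fintype.card ρ) {a : ρ → ℝ} (ha : a ⬝ᵥ a = 1) :
    Measure.pi (fun _ : ι => gaussianReal 0 1)
      {g | ¬ NearlyIsotropic (patternMatrix cl g) a
        (20 * K * √(Fintype.card ρ * Fintype.card κ)) (9 * K * Fintype.card κ)} ≤
      ENNReal.ofReal (3 * Real.exp (-Fintype.card κ)) := by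
  classical
  set N := (Fintype.card ρ : ℝ) with hN
  set d := (Fintype.card κ : ℝ) with hd
  have hd1 : 1 ≤ d := by
    rw [hd]; exact_mod_cast Fintype.card_pos
  have hK1' : (1 : ℝ) ≤ K := by exact_mod_cast hK1
  have hcard' : 36 * (K : ℝ) ^ 2 * d ≤ N := by rw [hd, hN]; exact_mod_cast hcard
  have hN0 : 0 < N := lt_of_lt_of_le (by positivity) hcard'
  set S := √(N * d) with hS
  have hS2 : S ^ 2 = N * d := Real.sq_sqrt (by positivity)
  have hS0 : 0 < S := Real.sqrt_pos.2 (by positivity)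
  have hKS : 6 * K * S ≤ N := by
    have : (6 * K * S) ^ 2 ≤ N ^ 2 := by
      rw [mul_pow, hS2]
      nlinarith
    exact le_of_sq_le_sq this hN0.le
  rw [pi_gaussianReal_apply]
  set γ := stdGaussian (EuclideanSpace ℝ ι)
  set M : EuclideanSpace ℝ ι → Matrix ρ κ ℝ := fun g => patternMatrix cl g
  set Q : EuclideanSpace ℝ ι → EuclideanSpace ℝ κ →ₗ[ℝ] EuclideanSpace ℝ κ := fun g =>
    Matrix.toEuclideanLin ((M g)ᵀ * M g - N • 1)
  have hQsymm : ∀ g, (Q g).IsSymmetric := fun g => by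
    rw [Matrix.isSymmetric_toEuclideanLin_iff, Matrix.IsHermitian]
    simp [Matrix.conjTranspose_eq_transpose_of_trivial]
  have hQin : ∀ g (y : EuclideanSpace ℝ κ), inner ℝ (Q g y) y =
      (M g *ᵥ y) ⬝ᵥ (M g *ᵥ y) - N * (y.ofLp ⬝ᵥ y) := fun g y => by
    rw [EuclideanSpace.inner_eq_star_dotProduct]
    simp only [Q, Matrix.toEuclideanLin, Matrix.toLpLin_apply, star_trivial, Matrix.sub_mulVec,
      dotProduct_sub, Matrix.smul_mulVec, Matrix.one_mulVec, dotProduct_smul, smul_eq_mul,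
      ← Matrix.mulVec_mulVec]
    rw [Matrix.dotProduct_mulVec _ (M g)ᵀ, Matrix.vecMul_transpose]
  have hnorm : ∀ y : EuclideanSpace ℝ κ, ‖y‖ = 1 → y.ofLp ⬝ᵥ y = 1 := fun y hy => by
    rw [← normSq_toLp, WithLp.toLp_ofLp, hy, one_pow]
  have hpt : ∀ y : EuclideanSpace ℝ κ, ‖y‖ = 1 →
      γ {g | 7 / 25 * (20 * K * S) ≤ |inner ℝ (Q g y) y|} ≤
        ENNReal.ofReal (2 * Real.exp (-3 * d)) := by
    intro y hy
    have hy1 := hnorm y hy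
    have hL : ∀ g, ‖patternMulVec cl y.ofLp g‖ ^ 2 = (M g *ᵥ y) ⬝ᵥ (M g *ᵥ y) :=
      fun g => normSq_toLp _
    set s := 7 / 25 * (20 * K * S)
    -- The parameter s/(4KN) minimizes −l s + 2 l² K N. It is admissible because s = 5.6 K S ≤ N,
    -- which is what `hcard` provides; the exponent becomes −s²/(8KN) = −3.92 K d.
    have hl : s / (4 * K * N) * K ≤ 1 / 4 := by
      rw [div_mul_eq_mul_div, div_le_iff₀ (by positivity)]
      simp only [s]; nlinarith
    have hexp : -(s / (4 * K * N)) * s + 2 * (s / (4 * K * N)) ^ 2 * K * N ≤ -3 * d := by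
      have : -(s / (4 * K * N)) * s + 2 * (s / (4 * K * N)) ^ 2 * K * N = - (3.92 * K * d) := by
        field_simp
        simp only [s]
        ring_nf
        rw [hS2]
        ring
      rw [this]
      nlinarith
    have h1 := stdGaussian_normSq_ge_le (patternMulVec cl y.ofLp)
      (EuclideanSpace.basisFun ι ℝ) (patternMulVec_normSq_le cl hK hy1)
      (l := s / (4 * K * N)) (by positivity) hl s
    have h2 := stdGaussian_normSq_le_le (patternMulVec cl y.ofLp)
      (EuclideanSpace.basisFun ι ℝ) (patternMulVec_normSq_le cl hK hy1)
      (l := s / (4 * K * N)) (by positivity) hl s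
    rw [sum_normSq_patternMulVec cl hcl hy1] at h1 h2
    have hsub : {g | s ≤ |inner ℝ (Q g y) y|} ⊆
        {g | N + s ≤ ‖patternMulVec cl y.ofLp g‖ ^ 2} ∪
          {g | ‖patternMulVec cl y.ofLp g‖ ^ 2 ≤ N - s} := by
      intro g (hg : s ≤ |inner ℝ (Q g y) y|)
      rw [hQin, hy1, ← hL, mul_one, le_abs] at hg
      rcases hg with hg | hg
      · left; show N + s ≤ _; linarith
      · right; show _ ≤ N - s; linarith
    rw [← ofReal_measureReal]
    apply ENNReal.ofReal_le_ofReal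
    calc γ.real _ ≤ γ.real _ := measureReal_mono hsub
      _ ≤ _ := measureReal_union_le _ _
      _ ≤ Real.exp (-3 * d) + Real.exp (-3 * d) :=
          add_le_add (h1.trans (Real.exp_le_exp.2 hexp)) (h2.trans (Real.exp_le_exp.2 hexp))
      _ = _ := by ring
  have hmeas : Measurable fun p : EuclideanSpace ℝ ι × EuclideanSpace ℝ κ =>
      inner ℝ (Q p.1 p.2) p.2 := by
    simp only [hQin, M, patternMatrix, Matrix.mulVec, dotProduct, Matrix.of_apply]
    fun_prop
  have hunif := measure_exists_quadratic_ge_le γ Q hQsymm hmeas (t := 20 * K * S)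
    (by positivity) hpt
  rw [finrank_euclideanSpace] at hunif
  have hvec : γ {g | 9 * K * d ≤ ‖patternVecMul cl a g‖ ^ 2} ≤
      ENNReal.ofReal (Real.exp (-d)) := by
    have htr := sum_normSq_patternVecMul_le cl hK ha
    have h1 := stdGaussian_normSq_ge_le (patternVecMul cl a)
      (EuclideanSpace.basisFun ι ℝ) (patternVecMul_normSq_le cl hK ha)
      (l := 1 / (4 * K)) (by positivity) (by field_simp; rfl) (8 * K * d)
    rw [← ofReal_measureReal]
    apply ENNReal.ofReal_le_ofReal
    refine (measureReal_mono ?_).trans (h1.trans (Real.exp_le_exp.2 ?_))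
    · intro g (hg : 9 * K * d ≤ _)
      show _ ≤ ‖patternVecMul cl a g‖ ^ 2
      linarith
    · set tr := ∑ i, ‖patternVecMul cl a (EuclideanSpace.basisFun ι ℝ i)‖ ^ 2
      have e : -(1 / (4 * (K : ℝ))) * (8 * K * d) + 2 * (1 / (4 * (K : ℝ))) ^ 2 * K * tr =
          - 2 * d + tr / (8 * K) := by field_simp; ring
      have : tr / (8 * K) ≤ d / 8 := by
        rw [div_le_div_iff₀ (by positivity) (by positivity)]
        nlinarith
      rw [e]; linarith
  have hsub : {x : EuclideanSpace ℝ ι | x.ofLp ∈ {g | ¬ NearlyIsotropic (patternMatrix cl g) a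
        (20 * K * S) (9 * K * d)}} ⊆
      {g | ∃ y, ‖y‖ = 1 ∧ 20 * K * S ≤ |inner ℝ (Q g y) y|} ∪
        {g | 9 * K * d ≤ ‖patternVecMul cl a g‖ ^ 2} := by
    intro g hg
    by_contra hcon
    simp only [Set.mem_union, Set.mem_ofPred_eq, not_or, not_exists, not_and, not_le] at hcon
    apply hg
    refine ⟨fun y => ?_, ?_⟩
    · rcases eq_or_ne y 0 with rfl | hy
      · simp
      have hy' := norm_toLp_pos hy
      set z := WithLp.toLp 2 y
      have h := hcon.1 (‖z‖⁻¹ • z) (by rw [norm_smul, norm_inv, norm_norm,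
        inv_mul_cancel₀ hy'.ne'])
      rw [map_smul, inner_smul_left, inner_smul_right, abs_mul, abs_mul] at h
      simp only [conj_trivial, abs_inv, abs_norm] at h
      rw [inv_mul_lt_iff₀ hy', inv_mul_lt_iff₀ hy', hQin] at h
      refine h.le.trans_eq ?_
      rw [← normSq_toLp y]; ring
    · have := hcon.2.le
      rw [patternVecMul] at this
      simp only [LinearMap.coe_mk, AddHom.coe_mk] at this
      rwa [normSq_toLp] at this
  refine (measure_mono hsub).trans ((measure_union_le _ _).trans
    ((add_le_add hunif hvec).trans ?_))
  have h5 : (5 : ENNReal) ^ Fintype.card κ = ENNReal.ofReal (5 ^ Fintype.card κ) := by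
    rw [ENNReal.ofReal_pow (by norm_num)]; norm_num
  rw [h5, ← ENNReal.ofReal_mul (by positivity), ← ENNReal.ofReal_add (by positivity)
    (by positivity)]
  apply ENNReal.ofReal_le_ofReal
  -- Since 5 ≤ e², the volume factor 5^d is absorbed by the pointwise bound 2 e^(-3d).
  have h6 : (5 : ℝ) ^ Fintype.card κ ≤ Real.exp (2 * d) := by
    rw [hd, mul_comm, Real.exp_nat_mul]
    gcongr
    have := Real.quadratic_le_exp_of_nonneg (show (0 : ℝ) ≤ 2 by norm_num)
    linarith
  have h7 : Real.exp (2 * d) * Real.exp (-3 * d) = Real.exp (-d) := by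
    rw [← Real.exp_add]; congr 1; ring
  nlinarith [Real.exp_pos (-3 * d)]

end Noise

/-! ### Spectral theory of operators close to rank one -/

section Spiked

variable {V : Type*} [NormedAddCommGroup V] [InnerProductSpace ℝ V]

/-- The symmetric operator `B` is the rank-one operator `θ b bᵀ` up to a relative error `δ`. -/
structure IsSpiked (B : V →ₗ[ℝ] V) (b : V) (θ δ : ℝ) : Prop where
  symm : B.IsSymmetric
  norm_eq : ‖b‖ = 1
  pos : 0 < θ
  nonneg : 0 ≤ δ
  le : δ ≤ 1 / 100
  quadratic : ∀ y, |inner ℝ (B y) y - θ * inner ℝ b y ^ 2| ≤ δ * θ * ‖y‖ ^ 2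

variable {B : V →ₗ[ℝ] V} {b : V} {θ δ : ℝ}

/-- The left side is the squared distance from x to the line through b. -/
lemma normSq_sub_inner_sq_le (hb : ‖b‖ = 1) (x : V) (c : ℝ) :
    ‖x‖ ^ 2 - inner ℝ b x ^ 2 ≤ ‖x - c • b‖ ^ 2 := by
  rw [norm_sub_sq_real, inner_smul_right, norm_smul, hb, real_inner_comm, mul_one, Real.norm_eq_abs,
    sq_abs]
  nlinarith [sq_nonneg (inner ℝ x b - c)]

lemma IsSpiked.abs_inner_sub_le (h : IsSpiked B b θ δ) (x y : V) :
    |inner ℝ (B x) y - θ * inner ℝ b x * inner ℝ b y| ≤ δ * θ * (‖x‖ * ‖y‖) := by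
  set Q : V →ₗ[ℝ] V := B - θ • (innerₛₗ ℝ b).smulRight b
  have hQ : ∀ x y, inner ℝ (Q x) y = inner ℝ (B x) y - θ * inner ℝ b x * inner ℝ b y := by
    intro x y
    simp [Q, inner_sub_left, inner_smul_left, mul_assoc]
  have hs : Q.IsSymmetric := fun x y => by
    rw [hQ, real_inner_comm (Q y) x, hQ, h.symm x y, real_inner_comm (B y) x]; ring
  rw [← hQ]
  refine abs_inner_le_of_quadratic_le hs (fun z => ?_) x y
  rw [hQ]
  convert h.quadratic z using 3
  ring

/-- Test the bilinear bound against the residual itself. -/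
lemma IsSpiked.norm_sub_le (h : IsSpiked B b θ δ) (x : V) :
    ‖B x - (θ * inner ℝ b x) • b‖ ≤ δ * θ * ‖x‖ := by
  set e := B x - (θ * inner ℝ b x) • b
  have h1 := h.abs_inner_sub_le x e
  have h2 : inner ℝ (B x) e - θ * inner ℝ b x * inner ℝ b e = ‖e‖ ^ 2 := by
    rw [← real_inner_self_eq_norm_sq]
    conv_rhs => rw [show inner ℝ e e = inner ℝ (B x - (θ * inner ℝ b x) • b) e from rfl]
    rw [inner_sub_left, inner_smul_left]; simp
  rw [h2, abs_of_nonneg (sq_nonneg _)] at h1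
  rcases (norm_nonneg e).eq_or_lt with h0 | h0
  · rw [← h0]
    have := h.nonneg
    have := h.pos
    positivity
  · nlinarith

/-- A unit vector with larger quadratic form than the spike is close to the spike. -/
lemma IsSpiked.one_sub_inner_sq_le (h : IsSpiked B b θ δ) {u : V} (hu : ‖u‖ = 1)
    (hmax : inner ℝ (B b) b ≤ inner ℝ (B u) u) : 1 - inner ℝ b u ^ 2 ≤ 4 * δ ^ 2 := by
  set c := inner ℝ b u with hc
  have hb1 : inner ℝ b b = 1 := by rw [real_inner_self_eq_norm_sq, h.norm_eq, one_pow]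
  have hc1 : c ^ 2 ≤ 1 := by
    have := abs_real_inner_le_norm b u
    rw [h.norm_eq, hu, mul_one] at this
    rw [← sq_abs]; exact pow_le_one₀ (abs_nonneg _) this
  -- The difference of the two quadratic forms factors through u − b and u + b, whose norms have
  -- product p = 2√(1 − c²). The inequality is then self-improving: 1 − c² ≤ δ p gives p ≤ 4δ and an
  -- error of order δ² instead of δ.
  have h1 := h.abs_inner_sub_le (u - b) (u + b)
  have hs : inner ℝ (B b) u = inner ℝ (B u) b := by rw [h.symm b u, real_inner_comm]
  have e1 : inner ℝ (B (u - b)) (u + b) = inner ℝ (B u) u - inner ℝ (B b) b := by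
    simp only [map_sub, inner_sub_left, inner_add_right, hs]; ring
  have e2 : inner ℝ b (u - b) * inner ℝ b (u + b) = c ^ 2 - 1 := by
    rw [inner_sub_right, inner_add_right, hb1]; ring
  have e3 : (‖u - b‖ * ‖u + b‖) ^ 2 = 4 * (1 - c ^ 2) := by
    rw [mul_pow, norm_sub_sq_real, norm_add_sq_real, hu, h.norm_eq, real_inner_comm, ← hc]; ring
  rw [e1, mul_assoc, e2] at h1
  set p := ‖u - b‖ * ‖u + b‖
  have hp0 : 0 ≤ p := by positivity
  have h2 : θ * (1 - c ^ 2) ≤ δ * θ * p := by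
    have := (abs_le.1 h1).2
    linarith
  have h3 : 1 - c ^ 2 ≤ δ * p := by
    have := h.pos
    nlinarith
  have h4 : p ≤ 4 * δ := by
    rcases hp0.eq_or_lt with h0 | h0
    · rw [← h0]; linarith [h.nonneg]
    · nlinarith
  nlinarith [h.nonneg]

/-- Since u is within 2δ of the line through b in the sense used here, a vector orthogonal to u is
nearly orthogonal to b. The spike then contributes 2δθ and the error term δθ. -/
lemma IsSpiked.norm_apply_le_of_orthogonal (h : IsSpiked B b θ δ) {u : V} (hu : ‖u‖ = 1)
    (hbu : 1 - inner ℝ b u ^ 2 ≤ 4 * δ ^ 2) {y : V} (hy : inner ℝ u y = 0) :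
    |inner ℝ b y| ≤ 2 * δ * ‖y‖ ∧ ‖B y‖ ≤ 3 * δ * θ * ‖y‖ := by
  have hδ := h.nonneg
  have hθ := h.pos
  have h1 : |inner ℝ b y| ≤ 2 * δ * ‖y‖ := by
    set c := inner ℝ b u with hc
    have e : inner ℝ b y = inner ℝ (b - c • u) y := by
      rw [inner_sub_left, inner_smul_left, hy]; simp
    have h2 : ‖b - c • u‖ ≤ 2 * δ := by
      refine le_of_sq_le_sq ?_ (by positivity)
      rw [norm_sub_sq_real, inner_smul_right, norm_smul, hu, h.norm_eq, mul_one, Real.norm_eq_abs,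
        sq_abs, ← hc]
      nlinarith
    rw [e]
    exact (abs_real_inner_le_norm _ _).trans (by gcongr)
  refine ⟨h1, ?_⟩
  have h3 := h.norm_sub_le y
  have e : B y = (B y - (θ * inner ℝ b y) • b) + (θ * inner ℝ b y) • b := by abel
  rw [e]
  refine (norm_add_le _ _).trans ?_
  rw [norm_smul, h.norm_eq, mul_one, Real.norm_eq_abs, abs_mul, abs_of_pos hθ]
  nlinarith

/-- One application of the spiked operator to a vector correlated with the spike. -/
lemma IsSpiked.apply_close (h : IsSpiked B b θ δ) {z : V} (hz : ‖z‖ ^ 2 < 8 * inner ℝ b z ^ 2) :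
    0 < ‖B z‖ ∧ (1 - 12 * δ) * ‖B z‖ ^ 2 ≤ inner ℝ b (B z) ^ 2 := by
  have hδ := h.nonneg
  have hδ1 := h.le
  have hθ := h.pos
  set β := inner ℝ b z
  have hβ : 0 < |β| := by
    rw [abs_pos]; intro h0; rw [h0] at hz
    nlinarith [sq_nonneg ‖z‖]
  have hzβ : ‖z‖ ≤ 3 * |β| := by
    refine le_of_sq_le_sq ?_ (by positivity)
    rw [mul_pow, sq_abs]; nlinarith [sq_nonneg β]
  have h1 := h.norm_sub_le z
  set x := B z
  have h2 := normSq_sub_inner_sq_le h.norm_eq x (θ * β)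
  set e := x - (θ * β) • b
  have he : ‖e‖ ≤ 3 * δ * θ * |β| := h1.trans (by nlinarith [mul_nonneg hδ hθ.le])
  have hbx : inner ℝ b x = θ * β + inner ℝ b e := by
    rw [inner_sub_right, inner_smul_right, real_inner_self_eq_norm_sq, h.norm_eq]; ring
  have hbe : |inner ℝ b e| ≤ 3 * δ * θ * |β| := by
    have := abs_real_inner_le_norm b e
    rw [h.norm_eq, one_mul] at this
    exact this.trans he
  have hθβ : 0 < θ * |β| := by positivity
  have h3 : 9 / 10 * (θ * |β|) ≤ |inner ℝ b x| := by
    have h1 : |θ * β| - |inner ℝ b e| ≤ |inner ℝ b x| := by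
      have := abs_sub_abs_le_abs_sub (θ * β) (-inner ℝ b e)
      rwa [abs_neg, sub_neg_eq_add, ← hbx] at this
    rw [abs_mul, abs_of_pos hθ] at h1
    nlinarith
  have h4 : |inner ℝ b x| ≤ ‖x‖ := by
    have := abs_real_inner_le_norm b x
    rwa [h.norm_eq, one_mul] at this
  have h5 : 0 < ‖x‖ := by nlinarith
  refine ⟨h5, ?_⟩
  have h6 : ‖e‖ ^ 2 ≤ (3 * δ * θ * |β|) ^ 2 := by gcongr
  have h7 : 9 / 10 * (θ * |β|) ≤ ‖x‖ := h3.trans h4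
  have h8 : (9 / 10 * (θ * |β|)) ^ 2 ≤ ‖x‖ ^ 2 := by gcongr
  have h9 : (3 * δ * θ * |β|) ^ 2 ≤ 12 * δ * ‖x‖ ^ 2 := by
    have : (3 * δ * θ * |β|) ^ 2 = δ * (9 * δ * (θ * |β|) ^ 2) := by ring
    rw [this]
    have : 9 * δ * (θ * |β|) ^ 2 ≤ 12 * ‖x‖ ^ 2 := by nlinarith [sq_nonneg (θ * |β|)]
    nlinarith
  linarith

/-- Two unit vectors that are close to a third one up to sign are close to each other. -/
lemma one_sub_le_inner_sq_of_close {v w v₀ : V} (hv : ‖v‖ = 1) (hw : ‖w‖ = 1) (h0 : ‖v₀‖ = 1)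
    {η : ℝ} (h1 : 1 - η ≤ inner ℝ v₀ v ^ 2) (h2 : 1 - η ≤ inner ℝ v₀ w ^ 2) (hη0 : 0 ≤ η)
    (hη : η ≤ 1 / 4) :
    1 - 4 * η ≤ inner ℝ v w ^ 2 := by
  set a := inner ℝ v₀ v
  set c := inner ℝ v₀ w
  -- Split both vectors along v₀: ⟨v, w⟩ = a c + ⟨p, q⟩ with |a c| ≥ 1 − η and |⟨p, q⟩| ≤ η.
  set p := v - a • v₀
  set q := w - c • v₀
  have h00 : inner ℝ v₀ v₀ = 1 := by rw [real_inner_self_eq_norm_sq, h0, one_pow]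
  have hp : ‖p‖ ^ 2 ≤ η := by
    rw [norm_sub_sq_real, inner_smul_right, norm_smul, hv, h0, real_inner_comm, mul_one,
      Real.norm_eq_abs, sq_abs]
    nlinarith
  have hq : ‖q‖ ^ 2 ≤ η := by
    rw [norm_sub_sq_real, inner_smul_right, norm_smul, hw, h0, real_inner_comm, mul_one,
      Real.norm_eq_abs, sq_abs]
    nlinarith
  have e : inner ℝ p q = inner ℝ v w - a * c := by
    simp only [p, q, inner_sub_left, inner_sub_right, inner_smul_left, inner_smul_right, h00,
      conj_trivial, real_inner_comm v₀ v]
    change inner ℝ v w - a * c - c * (a - a * 1) = _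
    ring
  have hpq : |inner ℝ p q| ≤ η := by
    refine (abs_real_inner_le_norm p q).trans ?_
    nlinarith [sq_nonneg (‖p‖ - ‖q‖)]
  have hac : 1 - η ≤ |a * c| := by
    refine le_of_sq_le_sq ?_ (abs_nonneg _)
    rw [sq_abs, mul_pow, sq (1 - η)]
    exact mul_le_mul h1 h2 (by linarith) (sq_nonneg _)
  have h3 : 1 - 2 * η ≤ |inner ℝ v w| := by
    have : |a * c| - |inner ℝ v w| ≤ |inner ℝ p q| := by
      rw [e, abs_sub_comm]
      exact abs_sub_abs_le_abs_sub _ _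
    linarith
  rw [← sq_abs]
  have : (1 - 2 * η) ^ 2 ≤ |inner ℝ v w| ^ 2 := pow_le_pow_left₀ (by linarith) h3 2
  nlinarith

variable [FiniteDimensional ℝ V]

lemma exists_top_eigenvector [Nontrivial V] (hB : B.IsSymmetric) :
    ∃ (u : V) (l : ℝ), ‖u‖ = 1 ∧ B u = l • u ∧
      ∀ y, ‖y‖ = 1 → inner ℝ (B y) y ≤ inner ℝ (B u) u := by
  have hcont : Continuous fun z : V => inner ℝ (B z) z := by
    have := B.continuous_of_finiteDimensional
    fun_prop
  obtain ⟨z, hz⟩ := exists_norm_eq V (zero_le_one (α := ℝ))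
  obtain ⟨u, hu, hmax⟩ := (isCompact_sphere (0 : V) 1).exists_isMaxOn
    ⟨z, by simpa using hz⟩ hcont.continuousOn
  have hu1 : ‖u‖ = 1 := by simpa using hu
  have hsa : IsSelfAdjoint (LinearMap.toContinuousLinearMap B) :=
    (LinearMap.isSelfAdjoint_toContinuousLinearMap_iff B).2
      ((LinearMap.isSymmetric_iff_isSelfAdjoint B).1 hB)
  have hev := hsa.hasEigenvector_of_isMaxOn (x₀ := u) (fun h => by simp [h] at hu1)
    (by rw [hu1]; exact hmax)
  exact ⟨u, _, hu1, hev.apply_eq_smul, fun y hy => hmax (by simpa using hy)⟩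

/-- Power iteration from a starting vector that is not orthogonal to the top eigenvector. -/
lemma IsSpiked.exists_power_iteration [Nontrivial V] (h : IsSpiked B b θ δ) :
    ∃ u : V, ‖u‖ = 1 ∧ ∀ (g : V) (L : ℕ), 0 < |inner ℝ u g| → 10 * ‖g‖ ≤ 2 ^ L * |inner ℝ u g| →
      ‖(B ^ L) g‖ ^ 2 < 8 * inner ℝ b ((B ^ L) g) ^ 2 := by
  obtain ⟨u, l, hu, hev, hmax⟩ := exists_top_eigenvector h.symm
  have hbu := h.one_sub_inner_sq_le hu (hmax b h.norm_eq)
  have hδ := h.nonneg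
  have hδ1 := h.le
  have hθ := h.pos
  have huu : inner ℝ u u = 1 := by rw [real_inner_self_eq_norm_sq, hu, one_pow]
  have hl : θ * (1 - δ) ≤ l := by
    have h1 := hmax b h.norm_eq
    have h2 := h.quadratic b
    rw [hev, inner_smul_left, huu] at h1
    rw [real_inner_self_eq_norm_sq, h.norm_eq] at h2
    have := (abs_le.1 h2).1
    simp only [conj_trivial] at h1
    norm_num at this
    linarith
  have hl0 : 0 < l := lt_of_lt_of_le (by nlinarith) hl
  have hρ : 3 * δ * θ ≤ l / 2 := by nlinarith
  refine ⟨u, hu, fun g L hg hL => ?_⟩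
  set a := inner ℝ u g
  -- Symmetry keeps the complement of u invariant. There B has norm at most l/2, so every step
  -- doubles the weight of u relative to the rest, whatever the signs of the other eigenvalues.
  have hind : ∀ L : ℕ, ∃ y, inner ℝ u y = 0 ∧ ‖y‖ ≤ (l / 2) ^ L * ‖g‖ ∧
      (B ^ L) g = (a * l ^ L) • u + y := by
    intro L
    induction L with
    | zero =>
      refine ⟨g - a • u, ?_, ?_, ?_⟩
      · rw [inner_sub_right, inner_smul_right, huu]; simp [a]
      · rw [pow_zero, one_mul]
        refine le_of_sq_le_sq ?_ (norm_nonneg _)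
        rw [norm_sub_sq_real, inner_smul_right, norm_smul, hu, mul_one, Real.norm_eq_abs,
          sq_abs, real_inner_comm]
        nlinarith [sq_nonneg a]
      · simp
    | succ L ih =>
      obtain ⟨y, hy1, hy2, hy3⟩ := ih
      refine ⟨B y, ?_, ?_, ?_⟩
      · rw [← h.symm u y, hev, inner_smul_left, hy1, mul_zero]
      · refine (h.norm_apply_le_of_orthogonal hu hbu hy1).2.trans ?_
        calc 3 * δ * θ * ‖y‖ ≤ l / 2 * ((l / 2) ^ L * ‖g‖) := by gcongr
          _ = _ := by ring
      · rw [pow_succ', Module.End.mul_apply, hy3, map_add, map_smul, hev, smul_smul]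
        congr 2; ring
  obtain ⟨y, hy1, hy2, hy3⟩ := hind L
  rw [hy3]
  set m := a * l ^ L
  have hm0 : 0 < |m| := by rw [abs_mul, abs_of_pos (pow_pos hl0 L)]; positivity
  have hym : ‖y‖ ≤ |m| / 10 := by
    have e : |m| = |a| * l ^ L := by rw [abs_mul, abs_of_pos (pow_pos hl0 L)]
    have h2 : (0 : ℝ) < 2 ^ L := by positivity
    calc ‖y‖ ≤ (l / 2) ^ L * ‖g‖ := hy2
      _ = l ^ L / 2 ^ L / 10 * (10 * ‖g‖) := by rw [div_pow]; ring
      _ ≤ l ^ L / 2 ^ L / 10 * (2 ^ L * |a|) := by gcongr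
      _ = |m| / 10 := by rw [e]; field_simp
  have hz : ‖m • u + y‖ ^ 2 = m ^ 2 + ‖y‖ ^ 2 := by
    rw [norm_add_sq_real, inner_smul_left, hy1, norm_smul, hu, Real.norm_eq_abs, mul_one, sq_abs]
    simp
  rw [hz, inner_add_right, inner_smul_right]
  have hby := (h.norm_apply_le_of_orthogonal hu hbu hy1).1
  have hc : 9 / 10 ≤ |inner ℝ b u| := by
    refine le_of_sq_le_sq ?_ (abs_nonneg _)
    rw [sq_abs]; nlinarith
  have h8 : 8 / 10 * |m| ≤ |m * inner ℝ b u + inner ℝ b y| := by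
    have h1 : |m * inner ℝ b u| - |inner ℝ b y| ≤ |m * inner ℝ b u + inner ℝ b y| := by
      have := abs_sub_abs_le_abs_sub (m * inner ℝ b u) (-inner ℝ b y)
      rwa [abs_neg, sub_neg_eq_add] at this
    rw [abs_mul] at h1
    have h2 : 2 * δ * ‖y‖ ≤ |m| / 10 := by nlinarith [norm_nonneg y]
    nlinarith
  have h9 : (8 / 10 * |m|) ^ 2 ≤ (m * inner ℝ b u + inner ℝ b y) ^ 2 := by
    rw [← sq_abs (m * inner ℝ b u + inner ℝ b y)]
    gcongr
  have h10 : ‖y‖ ^ 2 ≤ (|m| / 10) ^ 2 := by gcongr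
  rw [mul_pow, sq_abs] at h9
  rw [div_pow, sq_abs] at h10
  have : 0 < m ^ 2 := by rw [← sq_abs]; positivity
  nlinarith

end Spiked

/-! ### The recentred Gram matrix of a spiked matrix -/

section Matrices

variable {ρ κ : Type*} [Fintype ρ] [Fintype κ]

lemma inner_toLp_eq (x y : κ → ℝ) : inner ℝ (WithLp.toLp 2 x) (WithLp.toLp 2 y) = x ⬝ᵥ y := by
  rw [EuclideanSpace.inner_toLp_toLp, star_trivial, dotProduct_comm]

lemma norm_toLp_eq_one {x : κ → ℝ} (hx : x ⬝ᵥ x = 1) : ‖WithLp.toLp 2 x‖ = 1 := by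
  have := normSq_toLp x
  rw [hx] at this
  rw [← Real.sqrt_sq (norm_nonneg (WithLp.toLp 2 x)), this, Real.sqrt_one]

lemma abs_dotProduct_le (x y : κ → ℝ) : |x ⬝ᵥ y| ≤ √(x ⬝ᵥ x) * √(y ⬝ᵥ y) := by
  rw [← inner_toLp_eq, ← normSq_toLp, ← normSq_toLp, Real.sqrt_sq (norm_nonneg _),
    Real.sqrt_sq (norm_nonneg _)]
  exact abs_real_inner_le_norm _ _

variable [DecidableEq κ]

/-- The Gram matrix of the columns of `M`, recentred by the number of rows. -/
def centredGram (M : Matrix ρ κ ℝ) : Matrix κ κ ℝ := Mᵀ * M - (Fintype.card ρ : ℝ) • 1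

lemma inner_centredGram (M : Matrix ρ κ ℝ) (y : κ → ℝ) :
    inner ℝ (Matrix.toEuclideanLin (centredGram M) (WithLp.toLp 2 y)) (WithLp.toLp 2 y) =
      (M *ᵥ y) ⬝ᵥ (M *ᵥ y) - Fintype.card ρ * (y ⬝ᵥ y) := by
  rw [EuclideanSpace.inner_eq_star_dotProduct]
  simp only [centredGram, Matrix.toEuclideanLin, Matrix.toLpLin_apply, star_trivial,
    Matrix.sub_mulVec, dotProduct_sub, Matrix.smul_mulVec, Matrix.one_mulVec, dotProduct_smul,
    smul_eq_mul, ← Matrix.mulVec_mulVec]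
  rw [Matrix.dotProduct_mulVec _ Mᵀ, Matrix.vecMul_transpose]

/-- In the expansion of ‖(τ a bᵀ + A) y‖² − N‖y‖², only the cross term 2τ ⟨b, y⟩⟨aᵀA, y⟩ and the
recentred noise remain besides the spike; near isotropy bounds both. -/
lemma isSpiked_centredGram {A : Matrix ρ κ ℝ} {a : ρ → ℝ} {b : κ → ℝ} {τ t c δ : ℝ}
    (hA : NearlyIsotropic A a t c) (ha : a ⬝ᵥ a = 1) (hb : b ⬝ᵥ b = 1) (hτ : 0 < τ) (hδ0 : 0 ≤ δ)
    (hδ : δ ≤ 1 / 100) (h : 2 * τ * √c + t ≤ δ * τ ^ 2) :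
    IsSpiked (Matrix.toEuclideanLin (centredGram (τ • Matrix.vecMulVec a b + A)))
      (WithLp.toLp 2 b) (τ ^ 2) δ where
  symm := Matrix.isSymmetric_toEuclideanLin_iff.2 (by
    rw [Matrix.IsHermitian, centredGram]
    simp [Matrix.conjTranspose_eq_transpose_of_trivial])
  norm_eq := norm_toLp_eq_one hb
  pos := by positivity
  nonneg := hδ0
  le := hδ
  quadratic := by
    intro z
    obtain ⟨y, rfl⟩ : ∃ y, z = WithLp.toLp 2 y := ⟨z.ofLp, rfl⟩
    rw [inner_centredGram, inner_toLp_eq, normSq_toLp]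
    set β := b ⬝ᵥ y with hβ
    set r := a ᵥ* A with hr
    have e1 : (τ • Matrix.vecMulVec a b + A) *ᵥ y = (τ * β) • a + A *ᵥ y := by
      rw [Matrix.add_mulVec, Matrix.smul_mulVec, Matrix.vecMulVec_mulVec, ← hβ]
      ext i; simp; ring
    have e2 : a ⬝ᵥ (A *ᵥ y) = r ⬝ᵥ y := Matrix.dotProduct_mulVec _ _ _
    have e3 : (A *ᵥ y) ⬝ᵥ a = r ⬝ᵥ y := by rw [dotProduct_comm, e2]
    rw [e1]
    simp only [add_dotProduct, dotProduct_add, smul_dotProduct, dotProduct_smul, smul_eq_mul, ha,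
      e2, e3]
    have h1 := hA.1 y
    have hyy : 0 ≤ y ⬝ᵥ y := by rw [← normSq_toLp]; positivity
    set s := √(y ⬝ᵥ y) with hs
    have hs2 : s ^ 2 = y ⬝ᵥ y := Real.sq_sqrt hyy
    have hs0 : 0 ≤ s := Real.sqrt_nonneg _
    have h2 : |β| ≤ s := by
      have := abs_dotProduct_le b y
      rwa [hb, Real.sqrt_one, one_mul] at this
    have h3 : |r ⬝ᵥ y| ≤ √c * s :=
      (abs_dotProduct_le r y).trans (by gcongr; exact hA.2)
    have h4 : |β * (r ⬝ᵥ y)| ≤ √c * (y ⬝ᵥ y) := by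
      rw [abs_mul, ← hs2]
      calc |β| * |r ⬝ᵥ y| ≤ s * (√c * s) := by gcongr
        _ = _ := by ring
    set X := (A *ᵥ y) ⬝ᵥ (A *ᵥ y)
    have e6 : ∀ Z : ℝ, Z = 2 * τ * (β * (r ⬝ᵥ y)) + (X - Fintype.card ρ * (y ⬝ᵥ y)) →
        |Z| ≤ δ * τ ^ 2 * (y ⬝ᵥ y) := by
      rintro Z rfl
      refine (abs_add_le _ _).trans ?_
      rw [abs_mul, abs_of_pos (by positivity : 0 < 2 * τ)]
      calc _ ≤ 2 * τ * (√c * (y ⬝ᵥ y)) + t * (y ⬝ᵥ y) := by gcongr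
        _ = (2 * τ * √c + t) * (y ⬝ᵥ y) := by ring
        _ ≤ _ := by gcongr
    exact e6 _ (by ring)

/-- Recentring shifts the quadratic form by a constant on unit vectors, so the maximizers are
unchanged. -/
lemma IsTopRightSingularVector.one_sub_sq_le {M : Matrix ρ κ ℝ} {u b : κ → ℝ} {θ δ : ℝ}
    (hu : IsTopRightSingularVector M u) (hb : b ⬝ᵥ b = 1)
    (h : IsSpiked (Matrix.toEuclideanLin (centredGram M)) (WithLp.toLp 2 b) θ δ) :
    1 - (b ⬝ᵥ u) ^ 2 ≤ 4 * δ ^ 2 := by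
  rw [← inner_toLp_eq]
  refine h.one_sub_inner_sq_le (norm_toLp_eq_one hu.1) ?_
  rw [inner_centredGram, inner_centredGram, hb, hu.1]
  linarith [hu.2 b hb]

end Matrices

/-! ### Tensor powers, unfolding and reshaping -/

lemma tensorPower_dotProduct_self (p : ℕ) {n : ℕ} {v : Fin n → ℝ} (hv : v ⬝ᵥ v = 1) :
    tensorPower p v ⬝ᵥ tensorPower p v = 1 := by
  have h : ∀ α : Fin p → Fin n, tensorPower p v α * tensorPower p v α =
      ∏ i, (v (α i) * v (α i)) := fun α => by
    rw [tensorPower, Finset.prod_mul_distrib]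
  rw [dotProduct, Finset.sum_congr rfl fun α _ => h α]
  have := Finset.prod_univ_sum (fun _ : Fin p => (Finset.univ : Finset (Fin n)))
    (fun _ j => v j * v j)
  rw [Fintype.piFinset_univ] at this
  rw [← this]
  have hv' : ∑ j, v j * v j = 1 := hv
  simp [hv']

lemma unfold_spiked {k n p q : ℕ} (h : p + q = k) (τ : ℝ) (v₀ : Fin n → ℝ) (A : Tensor k n) :
    unfold h (spiked τ v₀ A) =
      τ • Matrix.vecMulVec (tensorPower p v₀) (tensorPower q v₀) + unfold h A := by
  subst h
  ext α β
  simp [unfold, spiked, tensorPower, Matrix.vecMulVec_apply, Fin.prod_univ_add]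

/-- A top left singular vector of a reshaped vector close to a power of `v₀` is close
to `v₀`. -/
lemma reshape_close {n m : ℕ} {v₀ : Fin n → ℝ} (hv : v₀ ⬝ᵥ v₀ = 1)
    {u : (Fin (m + 1) → Fin n) → ℝ} (hu : u ⬝ᵥ u = 1) {δ : ℝ} (hδ0 : 0 ≤ δ) (hδ : δ ≤ 1 / 100)
    (hub : 1 - (tensorPower (m + 1) v₀ ⬝ᵥ u) ^ 2 ≤ 4 * δ ^ 2) {w : Fin n → ℝ}
    (hw : IsTopRightSingularVector
      (Matrix.of fun (i : Fin n) (γ : Fin m → Fin n) => u (Fin.cons i γ : Fin (m + 1) → Fin n))ᵀ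
      w) :
    1 - 12 * δ ≤ (w ⬝ᵥ v₀) ^ 2 := by
  set X : Matrix (Fin n) (Fin m → Fin n) ℝ :=
    Matrix.of fun i γ => u (Fin.cons i γ : Fin (m + 1) → Fin n)
  set b := tensorPower (m + 1) v₀ with hbdef
  set c := tensorPower m v₀ with hcdef
  have hb1 : b ⬝ᵥ b = 1 := tensorPower_dotProduct_self _ hv
  have hc1 : c ⬝ᵥ c = 1 := tensorPower_dotProduct_self _ hv
  have habs : |b ⬝ᵥ u| ≤ 1 := by
    have := abs_dotProduct_le b u
    rwa [hb1, hu, Real.sqrt_one, mul_one] at this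
  -- A singular vector is determined only up to sign; σ picks the sign for which u is close to σ b.
  obtain ⟨σ, hσ1, hσ⟩ : ∃ σ : ℝ, |σ| = 1 ∧ σ * (b ⬝ᵥ u) = |b ⬝ᵥ u| := by
    rcases le_total 0 (b ⬝ᵥ u) with h | h
    · exact ⟨1, by simp, by rw [abs_of_nonneg h, one_mul]⟩
    · exact ⟨-1, by simp, by rw [abs_of_nonpos h]; ring⟩
  have hσ2 : σ * σ = 1 := by rw [← abs_mul_abs_self, hσ1, one_mul]
  set r := u - σ • b with hr
  have hr2 : r ⬝ᵥ r ≤ (3 * δ) ^ 2 := by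
    have : r ⬝ᵥ r = 2 - 2 * |b ⬝ᵥ u| := by
      rw [hr]
      simp only [sub_dotProduct, dotProduct_sub, smul_dotProduct, dotProduct_smul, smul_eq_mul,
        hb1, hu, dotProduct_comm u b]
      rw [← hσ]
      linear_combination hσ2
    rw [this]
    rw [← sq_abs] at hub
    nlinarith [abs_nonneg (b ⬝ᵥ u)]
  set R : Matrix (Fin n) (Fin m → Fin n) ℝ :=
    Matrix.of fun i γ => r (Fin.cons i γ : Fin (m + 1) → Fin n) with hR
  have hXR : ∀ y : Fin n → ℝ, Xᵀ *ᵥ y = (σ * (v₀ ⬝ᵥ y)) • c + Rᵀ *ᵥ y := by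
    intro y
    ext γ
    simp only [Matrix.mulVec, dotProduct, Matrix.transpose_apply, X, R, Matrix.of_apply, hr,
      Pi.add_apply, Pi.smul_apply, smul_eq_mul, Pi.sub_apply, Finset.mul_sum, Finset.sum_mul]
    rw [← Finset.sum_add_distrib]
    refine Finset.sum_congr rfl fun i _ => ?_
    have : b (Fin.cons i γ : Fin (m + 1) → Fin n) = v₀ i * c γ := by
      simp [hbdef, hcdef, tensorPower, Fin.prod_univ_succ]
    rw [this]; ring
  -- The operator norm is bounded by the Frobenius norm, which is the Euclidean norm of r.
  have hRy : ∀ y : Fin n → ℝ, y ⬝ᵥ y = 1 → √((Rᵀ *ᵥ y) ⬝ᵥ (Rᵀ *ᵥ y)) ≤ 3 * δ := by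
    intro y hy
    rw [Real.sqrt_le_left (by positivity)]
    refine le_trans ?_ hr2
    have hrr : r ⬝ᵥ r = ∑ γ : Fin m → Fin n, ∑ i, R i γ ^ 2 := by
      rw [dotProduct, ← (Fin.consEquiv fun _ : Fin (m + 1) => Fin n).sum_comp,
        Fintype.sum_prod_type, Finset.sum_comm]
      simp [hR, Fin.consEquiv, sq]
    rw [hrr, dotProduct]
    refine Finset.sum_le_sum fun γ _ => ?_
    rw [← sq]
    refine (Finset.sum_mul_sq_le_sq_mul_sq Finset.univ (fun i => R i γ) y).trans_eq ?_
    have hy' : ∑ i, y i ^ 2 = 1 := by simpa [dotProduct, sq] using hy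
    rw [hy', mul_one]
  have hnorm : ∀ x : (Fin m → Fin n) → ℝ, √(x ⬝ᵥ x) = ‖WithLp.toLp 2 x‖ := fun x => by
    rw [← normSq_toLp, Real.sqrt_sq (norm_nonneg _)]
  have hcn : ‖WithLp.toLp 2 c‖ = 1 := norm_toLp_eq_one hc1
  -- Up to 3δ, ‖Xᵀy‖ is |⟨v₀, y⟩|. Comparing the maximizer w with v₀ loses this error twice, hence
  -- |⟨v₀, w⟩| ≥ 1 − 6δ.
  have hdiff : ∀ y : Fin n → ℝ, y ⬝ᵥ y = 1 →
      abs (√((Xᵀ *ᵥ y) ⬝ᵥ (Xᵀ *ᵥ y)) - abs (v₀ ⬝ᵥ y)) ≤ 3 * δ := by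
    intro y hy
    have h1 := hRy y hy
    rw [hXR y, hnorm, WithLp.toLp_add, WithLp.toLp_smul]
    rw [hnorm] at h1
    have h2 : ‖(σ * (v₀ ⬝ᵥ y)) • WithLp.toLp 2 c‖ = |v₀ ⬝ᵥ y| := by
      rw [norm_smul, hcn, Real.norm_eq_abs, abs_mul, hσ1, one_mul, mul_one]
    rw [← h2]
    refine (abs_norm_sub_norm_le _ _).trans ?_
    rwa [add_sub_cancel_left]
  have h1 := (abs_le.1 (hdiff w hw.1)).2
  have h2 := (abs_le.1 (hdiff v₀ hv)).1
  have h3 := Real.sqrt_le_sqrt (hw.2 v₀ hv)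
  rw [hv, abs_one] at h2
  have h4 : 1 - 6 * δ ≤ |v₀ ⬝ᵥ w| := by linarith
  have h5 : (1 - 6 * δ) ^ 2 ≤ |v₀ ⬝ᵥ w| ^ 2 := pow_le_pow_left₀ (by linarith) h4 2
  rw [sq_abs, dotProduct_comm] at h5
  nlinarith [sq_nonneg δ]

/-! ### Correctness and cost of the machine programs -/

namespace Program

lemma run_seq (ω : ℕ → ℝ) (P Q : Program) (s : State) :
    (seq P Q).run ω s = Q.run ω (P.run ω s) := rfl

/-- Invariant rule for counted loops. -/
lemma run_loop_induction {ω : ℕ → ℝ} {a n : ℕ} {P : Program} {s : State} (hn : s.nat a = n)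
    (I : ℕ → State → Prop) (h0 : I 0 s.tick)
    (hstep : ∀ i < n, ∀ s', I i s' → I (i + 1) (P.run ω s'.tick)) :
    I n ((loop a P).run ω s) := by
  have : ∀ i ≤ n, I i ((fun s' : State => P.run ω s'.tick)^[i] s.tick) := by
    intro i
    induction i with
    | zero => exact fun _ => h0
    | succ i ih =>
      intro hi
      rw [Function.iterate_succ_apply']
      exact hstep i (by omega) _ (ih (by omega))
  have h := this n le_rfl
  rwa [← hn] at h ⊢

/-- The registers that hold the parameters of the program, and the input array, agree. -/
structure SameParams (s s' : State) : Prop where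
  nat0 : s'.nat 0 = s.nat 0
  nat1 : s'.nat 1 = s.nat 1
  nat2 : s'.nat 2 = s.nat 2
  nat3 : s'.nat 3 = s.nat 3
  arr0 : s'.arr 0 = s.arr 0

lemma SameParams.trans {s s' s'' : State} (h : SameParams s s') (h' : SameParams s' s'') :
    SameParams s s'' :=
  ⟨h'.nat0.trans h.nat0, h'.nat1.trans h.nat1, h'.nat2.trans h.nat2, h'.nat3.trans h.nat3,
    h'.arr0.trans h.arr0⟩

/-- Sets real register `0` to the inner product of array `1` with the row of array `0` that starts
at the cell in natural register `5`. -/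
def rowDot : Program :=
  seq (setReal 0 0) (seq (setNat 4 0) (loop 0
    (seq (addNat 8 5 4) (seq (load 1 0 8) (seq (load 2 1 4) (seq (mulReal 1 1 2)
      (seq (addReal 0 0 1) (addNat 4 4 1))))))))

/-- Natural register 1 must hold the constant 1, as increments take registers as operands. A column
costs six instructions and one step for the loop iteration. -/
lemma run_rowDot (ω : ℕ → ℝ) (s : State) (h1 : s.nat 1 = 1) :
    SameParams s (rowDot.run ω s) ∧ (rowDot.run ω s).nat 5 = s.nat 5 ∧
      (rowDot.run ω s).arr = s.arr ∧ (rowDot.run ω s).steps ≤ s.steps + 7 * s.nat 0 + 3 ∧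
      (rowDot.run ω s).real 0 =
        ∑ j ∈ Finset.range (s.nat 0), s.arr 0 (s.nat 5 + j) * s.arr 1 j := by
  rw [rowDot, run_seq, run_seq]
  have := run_loop_induction (ω := ω) (a := 0) (n := s.nat 0)
    (P := seq (addNat 8 5 4) (seq (load 1 0 8) (seq (load 2 1 4) (seq (mulReal 1 1 2)
      (seq (addReal 0 0 1) (addNat 4 4 1))))))
    (s := (setNat 4 0).run ω ((setReal 0 0).run ω s)) (by simp [run, State.putNat, State.putReal])
    (fun i s' => SameParams s s' ∧ s'.nat 5 = s.nat 5 ∧ s'.nat 4 = i ∧ s'.arr = s.arr ∧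
      s'.steps ≤ s.steps + 7 * i + 3 ∧
      s'.real 0 = ∑ j ∈ Finset.range i, s.arr 0 (s.nat 5 + j) * s.arr 1 j)
    (by
      refine ⟨⟨?_, ?_, ?_, ?_, ?_⟩, ?_, ?_, ?_, ?_, ?_⟩ <;>
        simp [run, State.putNat, State.putReal, State.tick])
    (by
      rintro i - s' ⟨⟨a0, a1, a2, a3, a4⟩, b1, b2, b3, b4, b5⟩
      refine ⟨⟨?_, ?_, ?_, ?_, ?_⟩, ?_, ?_, ?_, ?_, ?_⟩ <;>
        simp [run, State.putNat, State.putReal, State.tick, a0, a1, a2, a3, b1, b2, b3, b5, h1,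
          Finset.sum_range_succ]
      omega)
  obtain ⟨c1, c2, -, c3, c4, c5⟩ := this
  exact ⟨c1, c2, c3, c4, c5⟩

/-- Adds to array `2` the product of real register `0` with the row of array `0` that starts at the
cell in natural register `5`, minus array `1`. -/
def rowUpdate : Program :=
  seq (setNat 4 0) (loop 0
    (seq (addNat 8 5 4) (seq (load 1 0 8) (seq (mulReal 1 1 0) (seq (load 2 2 4)
      (seq (addReal 2 2 1) (seq (load 1 1 4) (seq (subReal 2 2 1) (seq (store 2 4 2)
        (addNat 4 4 1))))))))))

/-- Subtracting array 1 once per row adds up to the recentring term N x over all N rows. Thus N is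
never needed as a real number, which matters because naturals cannot be converted to reals on this
machine. -/
lemma run_rowUpdate (ω : ℕ → ℝ) (s : State) (h1 : s.nat 1 = 1) :
    SameParams s (rowUpdate.run ω s) ∧ (rowUpdate.run ω s).nat 5 = s.nat 5 ∧
      (rowUpdate.run ω s).arr 1 = s.arr 1 ∧
      (rowUpdate.run ω s).steps ≤ s.steps + 10 * s.nat 0 + 2 ∧
      ∀ j < s.nat 0, (rowUpdate.run ω s).arr 2 j =
        s.arr 2 j + s.arr 0 (s.nat 5 + j) * s.real 0 - s.arr 1 j := by
  rw [rowUpdate, run_seq]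
  have := run_loop_induction (ω := ω) (a := 0) (n := s.nat 0)
    (P := seq (addNat 8 5 4) (seq (load 1 0 8) (seq (mulReal 1 1 0) (seq (load 2 2 4)
      (seq (addReal 2 2 1) (seq (load 1 1 4) (seq (subReal 2 2 1) (seq (store 2 4 2)
        (addNat 4 4 1)))))))))
    (s := (setNat 4 0).run ω s) (by simp [run, State.putNat])
    (fun i s' => SameParams s s' ∧ s'.nat 5 = s.nat 5 ∧ s'.nat 4 = i ∧ s'.arr 1 = s.arr 1 ∧
      s'.real 0 = s.real 0 ∧ s'.steps ≤ s.steps + 10 * i + 2 ∧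
      ∀ j, s'.arr 2 j = if j < i then
        s.arr 2 j + s.arr 0 (s.nat 5 + j) * s.real 0 - s.arr 1 j else s.arr 2 j)
    (by
      refine ⟨⟨?_, ?_, ?_, ?_, ?_⟩, ?_, ?_, ?_, ?_, ?_, ?_⟩ <;>
        simp [run, State.putNat, State.tick])
    (by
      rintro i - s' ⟨⟨a0, a1, a2, a3, a4⟩, b1, b2, b3, b4, b5, b6⟩
      refine ⟨⟨?_, ?_, ?_, ?_, ?_⟩, ?_, ?_, ?_, ?_, ?_, ?_⟩ <;>
        simp [run, State.putNat, State.putReal, State.tick, a0, a1, a2, a3, a4, b1, b2, b3, b4, h1]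
      · omega
      · intro j
        rcases lt_trichotomy j i with h | h | h
        · simp [h.ne, b6, h]
          exact fun _ => by omega
        · subst h
          simp [b6]
        · have h3 : ¬ j < i := by omega
          simp [h.ne', b6, h3]
          exact fun _ => by omega)
  obtain ⟨c1, c2, -, c3, -, c4, c5⟩ := this
  exact ⟨c1, c2, c3, c4, fun j hj => (c5 j).trans (if_pos hj)⟩

/-- Moves array `2` to array `1` and clears array `2`. -/
def copyBack : Program :=
  seq (setNat 4 0) (loop 0
    (seq (load 1 2 4) (seq (store 1 4 1) (seq (setReal 1 0) (seq (store 2 4 1)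
      (addNat 4 4 1))))))

lemma run_copyBack (ω : ℕ → ℝ) (s : State) (h1 : s.nat 1 = 1) :
    SameParams s (copyBack.run ω s) ∧
      (copyBack.run ω s).steps ≤ s.steps + 6 * s.nat 0 + 2 ∧
      ∀ j < s.nat 0, (copyBack.run ω s).arr 1 j = s.arr 2 j ∧ (copyBack.run ω s).arr 2 j = 0 := by
  rw [copyBack, run_seq]
  have := run_loop_induction (ω := ω) (a := 0) (n := s.nat 0)
    (P := seq (load 1 2 4) (seq (store 1 4 1) (seq (setReal 1 0) (seq (store 2 4 1)
      (addNat 4 4 1)))))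
    (s := (setNat 4 0).run ω s) (by simp [run, State.putNat])
    (fun i s' => SameParams s s' ∧ s'.nat 4 = i ∧ s'.steps ≤ s.steps + 6 * i + 2 ∧
      ∀ j, (s'.arr 2 j = if j < i then 0 else s.arr 2 j) ∧
        (j < i → s'.arr 1 j = s.arr 2 j))
    (by
      refine ⟨⟨?_, ?_, ?_, ?_, ?_⟩, ?_, ?_, ?_⟩ <;>
        simp [run, State.putNat, State.tick])
    (by
      rintro i - s' ⟨⟨a0, a1, a2, a3, a4⟩, b1, b2, b3⟩
      refine ⟨⟨?_, ?_, ?_, ?_, ?_⟩, ?_, ?_, ?_⟩ <;>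
        simp [run, State.putNat, State.putReal, State.tick, a0, a1, a2, a3, a4, b1, h1]
      · omega
      · intro j
        rcases lt_trichotomy j i with h | h | h
        · simp [h.ne, (b3 j).1, (b3 j).2 h, h]
          exact fun _ => by omega
        · subst h
          simp [(b3 j).1]
        · have h3 : ¬ j < i := by omega
          simp [h.ne', (b3 j).1, h3]
          exact ⟨fun _ => by omega, fun _ => by omega⟩)
  obtain ⟨c1, -, c3, c4⟩ := this
  exact ⟨c1, c3, fun j hj => ⟨(c4 j).2 hj, (c4 j).1.trans (if_pos hj)⟩⟩

/-- One step of power iteration with the recentred Gram matrix of the unfolding of array `0`. -/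
def powerStep : Program :=
  seq (setNat 5 0) (seq (loop 2 (seq rowDot (seq rowUpdate (addNat 5 5 0)))) copyBack)

/-- The product is accumulated in array 2, which must therefore start at zero; `copyBack` restores
this for the next step. Register 5 walks through the row starts in strides of n. -/
lemma run_powerStep (ω : ℕ → ℝ) (s : State) (h1 : s.nat 1 = 1) (h2 : ∀ j < s.nat 0, s.arr 2 j = 0) :
    SameParams s (powerStep.run ω s) ∧
      (powerStep.run ω s).steps ≤
        s.steps + s.nat 2 * (17 * s.nat 0 + 7) + (6 * s.nat 0 + 4) ∧
      (∀ j < s.nat 0, (powerStep.run ω s).arr 2 j = 0) ∧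
      ∀ j < s.nat 0, (powerStep.run ω s).arr 1 j =
        ∑ r ∈ Finset.range (s.nat 2), (s.arr 0 (s.nat 0 * r + j) *
          (∑ i ∈ Finset.range (s.nat 0), s.arr 0 (s.nat 0 * r + i) * s.arr 1 i) - s.arr 1 j) := by
  rw [powerStep, run_seq, run_seq]
  have := run_loop_induction (ω := ω) (a := 2) (n := s.nat 2)
    (P := seq rowDot (seq rowUpdate (addNat 5 5 0)))
    (s := (setNat 5 0).run ω s) (by simp [run, State.putNat])
    (fun r s' => SameParams s s' ∧ s'.nat 5 = s.nat 0 * r ∧ s'.arr 1 = s.arr 1 ∧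
      s'.steps ≤ s.steps + r * (17 * s.nat 0 + 7) + 2 ∧
      ∀ j < s.nat 0, s'.arr 2 j = ∑ r ∈ Finset.range r, (s.arr 0 (s.nat 0 * r + j) *
          (∑ i ∈ Finset.range (s.nat 0), s.arr 0 (s.nat 0 * r + i) * s.arr 1 i) - s.arr 1 j))
    (by
      refine ⟨⟨?_, ?_, ?_, ?_, ?_⟩, ?_, ?_, ?_, ?_⟩ <;>
        simp [run, State.putNat, State.tick]
      exact h2)
    (by
      rintro r - s' ⟨a, b1, b2, b3, b4⟩
      rw [run_seq, run_seq]
      obtain ⟨d1, d2, d3, d4, d5⟩ := run_rowDot ω s'.tick (a.nat1.trans h1)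
      set t := rowDot.run ω s'.tick
      have a' : SameParams s t := (a.trans (s'' := s'.tick) ⟨rfl, rfl, rfl, rfl, rfl⟩).trans d1
      obtain ⟨u1, u2, u3, u4, u5⟩ := run_rowUpdate ω t (a'.nat1.trans h1)
      set q := rowUpdate.run ω t
      have a'' : SameParams s q := a'.trans u1
      have k0 : s'.tick.nat = s'.nat := rfl
      have k1 : s'.tick.arr = s'.arr := rfl
      have k2 : s'.tick.steps = s'.steps + 1 := rfl
      rw [k0, a.nat0, k2] at d4
      rw [a'.nat0] at u4
      rw [k0, k1, a.nat0, b1, b2, a.arr0] at d5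
      refine ⟨⟨?_, ?_, ?_, ?_, ?_⟩, ?_, ?_, ?_, ?_⟩
      · simpa [run, State.putNat] using a''.nat0
      · simpa [run, State.putNat] using a''.nat1
      · simpa [run, State.putNat] using a''.nat2
      · simpa [run, State.putNat] using a''.nat3
      · simpa [run, State.putNat] using a''.arr0
      · simp only [run, State.putNat, Function.update_self]
        rw [a''.nat0, u2, d2, k0, b1]; ring
      · simp only [run, State.putNat]
        rw [u3, d3, k1, b2]
      · simp only [run, State.putNat]
        have : (r + 1) * (17 * s.nat 0 + 7) = r * (17 * s.nat 0 + 7) + (17 * s.nat 0 + 7) := by ring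
        omega
      · intro j hj
        simp only [run, State.putNat]
        rw [u5 j (by rw [a'.nat0]; exact hj), d5, d3, d2, k0, k1, b1, b2, b4 j hj, a.arr0,
          Finset.sum_range_succ]
        ring)
  obtain ⟨c1, -, -, c3, c4⟩ := this
  set t := (loop 2 (seq rowDot (seq rowUpdate (addNat 5 5 0)))).run ω ((setNat 5 0).run ω s)
  obtain ⟨e1, e2, e3⟩ := run_copyBack ω t (c1.nat1.trans h1)
  rw [c1.nat0] at e2 e3
  refine ⟨c1.trans e1, ?_, fun j hj => (e3 j hj).2, fun j hj => ?_⟩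
  · omega
  · rw [(e3 j hj).1, c4 j hj]

end Program

/-- Scale to a unit vector; the zero vector becomes the first coordinate vector. -/
noncomputable def normalizeOrFirst {n : ℕ} (x : Fin n → ℝ) : Fin n → ℝ := fun i =>
  if 0 < x ⬝ᵥ x then x i / √(x ⬝ᵥ x) else if (i : ℕ) = 0 then 1 else x i

lemma normalizeOrFirst_dotProduct_self {n : ℕ} (hn : 1 ≤ n) (x : Fin n → ℝ) :
    normalizeOrFirst x ⬝ᵥ normalizeOrFirst x = 1 := by
  by_cases h : 0 < x ⬝ᵥ x
  · have : normalizeOrFirst x = (√(x ⬝ᵥ x))⁻¹ • x := by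
      ext i; simp [normalizeOrFirst, h, div_eq_inv_mul]
    rw [this, smul_dotProduct, dotProduct_smul, smul_eq_mul, smul_eq_mul, ← mul_assoc, ← mul_inv,
      Real.mul_self_sqrt h.le, inv_mul_cancel₀ h.ne']
  -- Here the last branch `x i` of the definition is zero. It has this form because the program
  -- overwrites only cell 0.
  · have hx : x = 0 := dotProduct_self_eq_zero.1
      (le_antisymm (not_lt.1 h) (by rw [← normSq_toLp]; positivity))
    subst hx
    have : normalizeOrFirst (0 : Fin n → ℝ) = Pi.single ⟨0, hn⟩ 1 := by
      ext i
      simp [normalizeOrFirst, Pi.single_apply, Fin.ext_iff]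
    rw [this]; simp

/-- The unfolding of a tensor whose columns are indexed by the first index. -/
def firstUnfolding {k n : ℕ} (T : Tensor (k + 1) n) : Matrix (Fin k → Fin n) (Fin n) ℝ :=
  Matrix.of fun a j => T (Fin.cons j a : Fin (k + 1) → Fin n)

/-- The number of power iterations. -/
def iterationCount (n : ℕ) : ℕ := 5 + 11 * Nat.clog 2 n

namespace Program

/-- Computes the constant `1`, the number `n ^ k` of rows, and the number of iterations. -/
def setup (k : ℕ) : Program :=
  seq (setNat 1 1) (seq (setNat 2 1) (seq (setNat 6 k) (seq (loop 6 (mulNat 2 2 0))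
    (seq (setNat 7 1) (seq (setNat 3 5) (seq (setNat 6 11)
      (loop 0 (ifNat 7 0 (seq (addNat 7 7 7) (addNat 3 3 6)) (setNat 9 0)))))))))

/-- The rounded-up binary logarithm is found by doubling register 7 until it reaches n, adding 11 to
register 3 each time. Counted loops cannot stop early, so the loop runs n times and idles
afterwards; n rounds suffice because n < 2^n. -/
lemma run_setup (k : ℕ) (ω : ℕ → ℝ) (s : State) :
    let s' := (setup k).run ω s
    s'.nat 0 = s.nat 0 ∧ s'.nat 1 = 1 ∧ s'.nat 2 = s.nat 0 ^ k ∧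
      s'.nat 3 = iterationCount (s.nat 0) ∧ s'.arr = s.arr ∧ s'.drawn = s.drawn ∧
      s'.steps ≤ s.steps + 2 * k + 4 * s.nat 0 + 8 := by
  simp only [setup, run_seq]
  have h1 := run_loop_induction (ω := ω) (a := 6) (n := k) (P := mulNat 2 2 0)
    (s := (setNat 6 k).run ω ((setNat 2 1).run ω ((setNat 1 1).run ω s)))
    (by simp [run, State.putNat])
    (fun i s' => s'.nat 0 = s.nat 0 ∧ s'.nat 1 = 1 ∧ s'.nat 2 = s.nat 0 ^ i ∧ s'.arr = s.arr ∧
      s'.drawn = s.drawn ∧ s'.steps ≤ s.steps + 2 * i + 4)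
    (by refine ⟨?_, ?_, ?_, ?_, ?_, ?_⟩ <;> simp [run, State.putNat, State.tick])
    (by
      rintro i - s' ⟨a1, a2, a3, a4, a5, a6⟩
      refine ⟨?_, ?_, ?_, ?_, ?_, ?_⟩ <;>
        simp [run, State.putNat, State.tick, a1, a2, a3, a4, a5, pow_succ]
      omega)
  set t := (loop 6 (mulNat 2 2 0)).run ω
    ((setNat 6 k).run ω ((setNat 2 1).run ω ((setNat 1 1).run ω s)))
  obtain ⟨b1, b2, b3, b4, b5, b6⟩ := h1
  have h2 := run_loop_induction (ω := ω) (a := 0) (n := s.nat 0)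
    (P := ifNat 7 0 (seq (addNat 7 7 7) (addNat 3 3 6)) (setNat 9 0))
    (s := (setNat 6 11).run ω ((setNat 3 5).run ω ((setNat 7 1).run ω t)))
    (by simp [run, State.putNat, b1])
    -- m counts the doublings so far; the last disjunct says that either every round doubled or the
    -- target has been reached.
    (fun i s' => ∃ m, s'.nat 0 = s.nat 0 ∧ s'.nat 1 = 1 ∧ s'.nat 2 = s.nat 0 ^ k ∧ s'.arr = s.arr ∧
      s'.drawn = s.drawn ∧ s'.steps ≤ s.steps + 2 * k + 4 * i + 8 ∧ s'.nat 6 = 11 ∧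
      s'.nat 3 = 5 + 11 * m ∧ s'.nat 7 = 2 ^ m ∧ m ≤ Nat.clog 2 (s.nat 0) ∧
      (i ≤ m ∨ s.nat 0 ≤ 2 ^ m))
    (by
      refine ⟨0, ?_, ?_, ?_, ?_, ?_, ?_, ?_, ?_, ?_, ?_, ?_⟩ <;>
        simp [run, State.putNat, State.tick, b1, b2, b3, b4, b5]
      omega)
    (by
      rintro i - s' ⟨m, a0, a1, a2, a3, a4, a5, a6, a7, a8, a9, a10⟩
      by_cases hlt : 2 ^ m < s.nat 0
      · have hm : m < Nat.clog 2 (s.nat 0) := (Nat.lt_clog_iff_pow_lt one_lt_two).2 hlt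
        refine ⟨m + 1, ?_, ?_, ?_, ?_, ?_, ?_, ?_, ?_, ?_, hm, ?_⟩
        on_goal 10 => left; omega
        all_goals
          simp [run, State.putNat, State.tick, a0, a1, a2, a3, a4, a6, a7, a8, hlt, pow_succ]
        all_goals omega
      · refine ⟨m, ?_, ?_, ?_, ?_, ?_, ?_, ?_, ?_, ?_, a9, Or.inr (not_lt.1 hlt)⟩ <;>
          simp [run, State.putNat, State.tick, a0, a1, a2, a3, a4, a6, a7, a8, hlt]
        omega)
  obtain ⟨m, a0, a1, a2, a3, a4, a5, a6, a7, a8, a9, a10⟩ := h2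
  have hm : m = Nat.clog 2 (s.nat 0) := by
    refine le_antisymm a9 (Nat.clog_le_of_le_pow ?_)
    rcases a10 with h | h
    · exact (Nat.lt_two_pow_self).le.trans (Nat.pow_le_pow_right two_pos h)
    · exact h
  refine ⟨a0, a1, a2, ?_, a3, a4, a5⟩
  rw [a7, hm, iterationCount]

/-- Fills array `1` with samples. -/
def sampleVector : Program :=
  seq (setNat 4 0) (loop 0 (seq (sample 1) (seq (store 1 4 1) (addNat 4 4 1))))

lemma run_sampleVector (ω : ℕ → ℝ) (s : State) (h1 : s.nat 1 = 1) (hd : s.drawn = 0) :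
    SameParams s (sampleVector.run ω s) ∧ (sampleVector.run ω s).arr 2 = s.arr 2 ∧
      (sampleVector.run ω s).steps ≤ s.steps + 4 * s.nat 0 + 2 ∧
      ∀ j < s.nat 0, (sampleVector.run ω s).arr 1 j = ω j := by
  rw [sampleVector, run_seq]
  have := run_loop_induction (ω := ω) (a := 0) (n := s.nat 0)
    (P := seq (sample 1) (seq (store 1 4 1) (addNat 4 4 1)))
    (s := (setNat 4 0).run ω s) (by simp [run, State.putNat])
    (fun i s' => SameParams s s' ∧ s'.nat 4 = i ∧ s'.arr 2 = s.arr 2 ∧ s'.drawn = i ∧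
      s'.steps ≤ s.steps + 4 * i + 2 ∧ ∀ j < i, s'.arr 1 j = ω j)
    (by
      refine ⟨⟨?_, ?_, ?_, ?_, ?_⟩, ?_, ?_, ?_, ?_, ?_⟩ <;>
        simp [run, State.putNat, State.tick, hd])
    (by
      rintro i - s' ⟨⟨a0, a1, a2, a3, a4⟩, b1, b2, b3, b4, b5⟩
      refine ⟨⟨?_, ?_, ?_, ?_, ?_⟩, ?_, ?_, ?_, ?_, ?_⟩ <;>
        simp [run, State.putNat, State.putReal, State.tick, a0, a1, a2, a3, a4, b1, b2, b3, h1]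
      · omega
      · intro j hj
        rcases (Nat.lt_succ_iff.1 (Nat.lt_succ_of_le hj)).lt_or_eq with h | h
        · simp [h.ne, b5 j h]
        · simp [h])
  obtain ⟨c1, -, c2, -, c3, c4⟩ := this
  exact ⟨c1, c2, c3, c4⟩

/-- Normalizes array `1`. -/
def normalize : Program :=
  seq (setReal 0 0) (seq (setNat 4 0) (seq
    (loop 0 (seq (load 1 1 4) (seq (mulReal 1 1 1) (seq (addReal 0 0 1) (addNat 4 4 1)))))
    (seq (setReal 1 0) (ifReal 1 0
      (seq (sqrtReal 0 0) (seq (setNat 4 0)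
        (loop 0 (seq (load 2 1 4) (seq (divReal 2 2 0) (seq (store 1 4 2) (addNat 4 4 1)))))))
      (seq (setReal 2 1) (seq (setNat 4 0) (store 1 4 2)))))))

lemma run_normalize (ω : ℕ → ℝ) (s : State) (h1 : s.nat 1 = 1) :
    (normalize.run ω s).steps ≤ s.steps + 10 * s.nat 0 + 12 ∧
      ∀ j : Fin (s.nat 0), (normalize.run ω s).arr 1 j =
        normalizeOrFirst (fun i : Fin (s.nat 0) => s.arr 1 i) j := by
  simp only [normalize, run_seq]
  have h2 := run_loop_induction (ω := ω) (a := 0) (n := s.nat 0)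
    (P := seq (load 1 1 4) (seq (mulReal 1 1 1) (seq (addReal 0 0 1) (addNat 4 4 1))))
    (s := (setNat 4 0).run ω ((setReal 0 0).run ω s)) (by simp [run, State.putNat, State.putReal])
    (fun i s' => s'.nat 0 = s.nat 0 ∧ s'.nat 1 = 1 ∧ s'.nat 4 = i ∧ s'.arr = s.arr ∧
      s'.real 0 = ∑ j ∈ Finset.range i, s.arr 1 j * s.arr 1 j ∧
      s'.steps ≤ s.steps + 5 * i + 3)
    (by refine ⟨?_, ?_, ?_, ?_, ?_, ?_⟩ <;> simp [run, State.putNat, State.putReal, State.tick, h1])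
    (by
      rintro i - s' ⟨a1, a2, a3, a4, a5, a6⟩
      refine ⟨?_, ?_, ?_, ?_, ?_, ?_⟩ <;>
        simp [run, State.putNat, State.putReal, State.tick, a1, a2, a3, a4, a5,
          Finset.sum_range_succ]
      omega)
  set t := (loop 0 _).run ω ((setNat 4 0).run ω ((setReal 0 0).run ω s))
  obtain ⟨a1, a2, -, a4, a5, a6⟩ := h2
  set x : Fin (s.nat 0) → ℝ := fun i => s.arr 1 i with hx
  have hxx : x ⬝ᵥ x = ∑ j ∈ Finset.range (s.nat 0), s.arr 1 j * s.arr 1 j := by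
    rw [dotProduct, ← Fin.sum_univ_eq_sum_range (fun j => s.arr 1 j * s.arr 1 j)]
  rw [← hxx] at a5
  set q := (setReal 1 0).run ω t with hq
  have q0 : q.nat = t.nat := rfl
  have q1 : q.arr = t.arr := rfl
  have q2 : q.real 1 = 0 := by simp [hq, run, State.putReal]
  have q3 : q.real 0 = x ⬝ᵥ x := by simp [hq, run, State.putReal, a5]
  have q4 : q.steps = t.steps + 1 := rfl
  rw [run, q2, q3]
  by_cases hpos : 0 < x ⬝ᵥ x
  · rw [if_pos hpos, run_seq, run_seq]
    have h3 := run_loop_induction (ω := ω) (a := 0) (n := s.nat 0)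
      (P := seq (load 2 1 4) (seq (divReal 2 2 0) (seq (store 1 4 2) (addNat 4 4 1))))
      (s := (setNat 4 0).run ω ((sqrtReal 0 0).run ω q.tick))
      (by simp [run, State.putNat, State.putReal, State.tick, q0, a1])
      (fun i s' => s'.nat 0 = s.nat 0 ∧ s'.nat 1 = 1 ∧ s'.nat 4 = i ∧
        s'.real 0 = √(x ⬝ᵥ x) ∧ s'.steps ≤ s.steps + 5 * s.nat 0 + 5 * i + 8 ∧
        ∀ j, s'.arr 1 j = if j < i then s.arr 1 j / √(x ⬝ᵥ x) else s.arr 1 j)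
      (by
        refine ⟨?_, ?_, ?_, ?_, ?_, ?_⟩ <;>
          simp [run, State.putNat, State.putReal, State.tick, q0, q1, q3, q4, a1, a2, a4]
        omega)
      (by
        rintro i - s' ⟨b1, b2, b3, b4, b5, b6⟩
        refine ⟨?_, ?_, ?_, ?_, ?_, ?_⟩ <;>
          simp [run, State.putNat, State.putReal, State.tick, b1, b2, b3, b4]
        · omega
        · intro j
          rcases lt_trichotomy j i with h | h | h
          · simp [h.ne, b6, h]
            exact fun _ => by omega
          · subst h
            simp [b6]
          · have h3 : ¬ j < i := by omega
            simp [h.ne', b6, h3]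
            exact fun _ => by omega)
    obtain ⟨-, -, -, -, b5, b6⟩ := h3
    refine ⟨by omega, fun j => ?_⟩
    rw [b6, if_pos j.2, normalizeOrFirst, if_pos hpos]
  · rw [if_neg hpos]
    refine ⟨?_, fun j => ?_⟩
    · simp [run, State.putNat, State.putReal, State.tick, q4]
      omega
    · rw [normalizeOrFirst, if_neg hpos]
      simp [run, State.putNat, State.putReal, State.tick, q1, a4, Function.update_apply, hx]

/-- Power iteration with the recentred Gram matrix of the first unfolding of the input. -/
def powerIteration (k : ℕ) : Program :=
  seq (setup k) (seq sampleVector (seq (loop 3 powerStep) normalize))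

/-- The first tensor index varies fastest in memory, so each row of this unfolding is a contiguous
block of n cells. -/
lemma inputState_arr {k n : ℕ} (T : Tensor (k + 1) n) (a : Fin k → Fin n) (j : Fin n) :
    (inputState T).arr 0 (n * (finFunctionFinEquiv a : ℕ) + j) = firstUnfolding T a j := by
  have e : n * (finFunctionFinEquiv a : ℕ) + j =
      (finFunctionFinEquiv (Fin.cons j a : Fin (k + 1) → Fin n) : ℕ) := by
    rw [finFunctionFinEquiv_apply, finFunctionFinEquiv_apply, Fin.sum_univ_succ, Finset.mul_sum]
    simp only [Fin.cons_zero, Fin.val_zero, pow_zero, mul_one, Fin.cons_succ, Fin.val_succ]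
    rw [add_comm]
    congr 1
    exact Finset.sum_congr rfl fun i _ => by ring
  have hlt := (finFunctionFinEquiv (Fin.cons j a : Fin (k + 1) → Fin n)).2
  rw [e]
  simp only [inputState, Function.update_self, firstUnfolding, Matrix.of_apply]
  rw [dif_pos hlt, Fin.eta, Equiv.symm_apply_apply]

lemma sum_range_pow {k n : ℕ} (f : ℕ → ℝ) :
    ∑ r ∈ Finset.range (n ^ k), f r = ∑ a : Fin k → Fin n, f (finFunctionFinEquiv a) := by
  rw [← Fin.sum_univ_eq_sum_range, ← (finFunctionFinEquiv (m := n) (n := k)).sum_comp]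

lemma centredGram_mulVec_apply {ρ κ : Type*} [Fintype ρ] [Fintype κ] [DecidableEq κ]
    (M : Matrix ρ κ ℝ) (x : κ → ℝ) (j : κ) :
    (centredGram M *ᵥ x) j = ∑ a, (M a j * (∑ i, M a i * x i) - x j) := by
  rw [centredGram, Matrix.sub_mulVec, Matrix.smul_mulVec, Matrix.one_mulVec, ← Matrix.mulVec_mulVec,
    Finset.sum_sub_distrib]
  simp only [Pi.sub_apply, Pi.smul_apply, smul_eq_mul, Matrix.mulVec, dotProduct,
    Matrix.transpose_apply, Finset.sum_const, Finset.card_univ, nsmul_eq_mul]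

/-- A deterministic description of the output and cost for every input and sample stream; all
probability is left to the analysis of this formula. -/
lemma run_powerIteration (k : ℕ) {n : ℕ} (T : Tensor (k + 1) n) (ω : ℕ → ℝ) :
    (powerIteration k).output T ω = normalizeOrFirst
        ((centredGram (firstUnfolding T) ^ iterationCount n) *ᵥ fun i : Fin n => ω i) ∧
      (powerIteration k).time T ω ≤ 2 * k + 18 * n + 23 +
        iterationCount n * (n ^ k * (17 * n + 7) + 6 * n + 5) := by
  simp only [Program.time, powerIteration, run_seq]
  have hn : (inputState T).nat 0 = n := by simp [inputState]
  obtain ⟨a0, a1, a2, a3, a4, a5, a6⟩ := run_setup k ω (inputState T)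
  set s := (setup k).run ω (inputState T)
  rw [hn] at a0 a2 a3 a6
  obtain ⟨b0, b1, b2, b3⟩ := run_sampleVector ω s a1 (a5.trans rfl)
  set t := sampleVector.run ω s
  rw [a0] at b2 b3
  have t0 := b0.nat0.trans a0
  have t1 := b0.nat1.trans a1
  have t2 := b0.nat2.trans a2
  have tarr : t.arr 0 = (inputState T).arr 0 := b0.arr0.trans (by rw [a4])
  set G := centredGram (firstUnfolding T)
  set g : Fin n → ℝ := fun i => ω i
  have hin : (inputState T).steps = 0 := rfl
  have h := run_loop_induction (ω := ω) (a := 3) (n := iterationCount n) (P := powerStep) (s := t)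
    (b0.nat3.trans a3)
    (fun i s' => SameParams t s' ∧ (∀ j < n, s'.arr 2 j = 0) ∧
      s'.steps ≤ t.steps + i * (n ^ k * (17 * n + 7) + 6 * n + 5) + 1 ∧
      ∀ j : Fin n, s'.arr 1 j = ((G ^ i) *ᵥ g) j)
    (by
      refine ⟨⟨rfl, rfl, rfl, rfl, rfl⟩, fun j _ => ?_, by simp [State.tick], fun j => ?_⟩
      · simp [State.tick, b1, a4, inputState]
      · rw [pow_zero, Matrix.one_mulVec]
        exact b3 j j.2)
    (by
      rintro i - s' ⟨c0, c1, c2, c3⟩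
      have n0 : s'.tick.nat 0 = n := c0.nat0.trans t0
      have n2 : s'.tick.nat 2 = n ^ k := c0.nat2.trans t2
      have n3 : s'.tick.arr 0 = (inputState T).arr 0 := c0.arr0.trans tarr
      have n4 : s'.tick.steps = s'.steps + 1 := rfl
      obtain ⟨d0, d1, d2, d3⟩ := run_powerStep ω s'.tick (c0.nat1.trans t1)
        (by rw [n0]; exact c1)
      rw [n0, n2, n4] at d1
      rw [n0] at d2
      rw [n0, n2, n3] at d3
      refine ⟨(c0.trans (s'' := s'.tick) ⟨rfl, rfl, rfl, rfl, rfl⟩).trans d0, d2, ?_, fun j => ?_⟩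
      · rw [add_mul, one_mul]; omega
      · rw [d3 j j.2, sum_range_pow, pow_succ', ← Matrix.mulVec_mulVec, centredGram_mulVec_apply]
        refine Finset.sum_congr rfl fun a _ => ?_
        rw [inputState_arr, ← Fin.sum_univ_eq_sum_range (fun i => (inputState T).arr 0
          (n * (finFunctionFinEquiv a : ℕ) + i) * s'.tick.arr 1 i)]
        simp only [inputState_arr]
        have e2 : ∀ i' : Fin n, s'.tick.arr 1 i' = ((G ^ i) *ᵥ g) i' := c3
        simp only [e2])
  set q := (loop 3 powerStep).run ω t
  obtain ⟨c0, -, c2, c3⟩ := h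
  have q0 : q.nat 0 = n := c0.nat0.trans t0
  obtain ⟨d1, d2⟩ := run_normalize ω q (c0.nat1.trans t1)
  constructor
  · funext j
    have hfun : (fun i : Fin n => q.arr 1 i) = (G ^ iterationCount n) *ᵥ g := funext c3
    rw [← hfun]
    change (normalize.run ω q).arr 1 j = _
    -- The index type in `d2` is `Fin (q.nat 0)`; generalizing first allows n to be replaced by
    -- `q.nat 0`.
    revert d2
    generalize normalize.run ω q = q'
    clear_value q
    subst q0
    exact fun d2 => d2 j
  · rw [q0] at d1
    omega

end Program

/-! ### Nearly linear running time -/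

lemma iterationCount_le {n : ℕ} (hn : 1 ≤ n) :
    (iterationCount n : ℝ) ≤ 22 * (1 + Real.log n) := by
  have hlog : 0 ≤ Real.log n := Real.log_nonneg (by exact_mod_cast hn)
  -- Uses 2^(clog − 1) < n and log 2 ≥ 1/2.
  have h : (Nat.clog 2 n : ℝ) ≤ 1 + 2 * Real.log n := by
    rcases hn.eq_or_lt with rfl | h1
    · simp
    have h2 := Nat.pow_pred_clog_lt_self one_lt_two h1
    have h3 : 0 < Nat.clog 2 n := Nat.clog_pos one_lt_two h1
    obtain ⟨m, hm⟩ := Nat.exists_eq_succ_of_ne_zero h3.ne'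
    rw [hm] at h2 ⊢
    simp only [Nat.pred_succ] at h2
    have h4 : (2 : ℝ) ^ m ≤ n := by exact_mod_cast h2.le
    have h5 := Real.log_le_log (by positivity) h4
    rw [Real.log_pow] at h5
    have := Real.log_two_gt_d9
    push_cast
    nlinarith [(Nat.cast_nonneg m : (0 : ℝ) ≤ m)]
  rw [iterationCount]
  push_cast
  linarith

lemma nearlyLinearTime_powerIteration (k : ℕ) :
    (Program.powerIteration k).NearlyLinearTime (k + 1) := by
  -- 811 = 18 + 23 + 22 · 35: the overhead outside the iterations, and the iteration count times the
  -- cost of one iteration.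
  refine ⟨2 * k + 811, 1, fun n hn T ω => ?_⟩
  have h := (Program.run_powerIteration k T ω).2
  have h' : ((Program.powerIteration k).time T ω : ℝ) ≤ 2 * k + 18 * n + 23 +
      iterationCount n * (n ^ k * (17 * n + 7) + 6 * n + 5) := by exact_mod_cast h
  have hn1 : (1 : ℝ) ≤ n := by exact_mod_cast hn
  have hlog : 0 ≤ Real.log n := Real.log_nonneg hn1
  have hL := iterationCount_le hn
  have hk : (1 : ℝ) ≤ (n : ℝ) ^ k := one_le_pow₀ hn1
  set X : ℝ := (n : ℝ) ^ (k + 1) with hX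
  have hXk : X = n ^ k * n := pow_succ _ _
  have hX1 : (n : ℝ) ≤ X := by rw [hXk]; nlinarith
  have hX2 : (n : ℝ) ^ k ≤ X := by rw [hXk]; nlinarith
  have h2 : (n : ℝ) ^ k * (17 * n + 7) + 6 * n + 5 ≤ 35 * X := by
    have : (n : ℝ) ^ k * (17 * n + 7) = 17 * X + 7 * n ^ k := by rw [hXk]; ring
    linarith
  have h3 : (iterationCount n : ℝ) * (n ^ k * (17 * n + 7) + 6 * n + 5) ≤
      22 * (1 + Real.log n) * (35 * X) := by gcongr
  have hkX : (k : ℝ) ≤ k * X := by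
    have : (0 : ℝ) ≤ k := Nat.cast_nonneg k
    nlinarith
  have h4 : (2 * k + 41) * X ≤ (2 * k + 41) * X * (1 + Real.log n) :=
    le_mul_of_one_le_right (by positivity) (by linarith)
  rw [pow_one]
  nlinarith

/-! ### Power iteration at the signal threshold -/

lemma firstUnfolding_spiked {k n : ℕ} (τ : ℝ) (v₀ : Fin n → ℝ) (A : Tensor (k + 1) n) :
    firstUnfolding (spiked τ v₀ A) =
      τ • Matrix.vecMulVec (tensorPower k v₀) v₀ + firstUnfolding A := by
  ext a j
  simp [firstUnfolding, spiked, tensorPower, Matrix.vecMulVec_apply, Fin.prod_univ_succ, mul_comm]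

/-- Signal strength at the threshold dominates the noise in the recentred Gram matrix. -/
lemma noise_le_signal {K N d h ε τ : ℝ} (hK : 1 ≤ K) (hd : 1 ≤ d) (hdN : d ≤ N)
    (hh : 0 ≤ h) (hh4 : h ^ 4 = N * d) (hε : ε ≤ 1) (hτ : 26000 * K * h ≤ ε * τ)
    (hτ0 : 0 < τ) :
    2 * τ * √(9 * K * d) + 20 * K * √(N * d) ≤ ε / 1000 * τ ^ 2 := by
  have h1 : √(N * d) = h ^ 2 := by
    rw [← hh4, show h ^ 4 = (h ^ 2) ^ 2 by ring, Real.sqrt_sq (by positivity)]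
  have h2 : d ≤ h ^ 2 := by
    refine le_of_sq_le_sq ?_ (by positivity)
    have : (h ^ 2) ^ 2 = N * d := by rw [← hh4]; ring
    rw [this]; nlinarith
  have h3 : √(9 * K * d) ≤ 3 * K * h := by
    rw [Real.sqrt_le_left (by positivity)]
    have : K * d ≤ K ^ 2 * h ^ 2 := by
      have : K * d ≤ K * h ^ 2 := by gcongr
      have : K * h ^ 2 ≤ K ^ 2 * h ^ 2 := by gcongr; nlinarith
      linarith
    nlinarith
  rw [h1]
  have hε0 : 0 ≤ ε * τ := le_trans (by positivity) hτ
  have h4 : 20 * K * h ^ 2 ≤ 20 * K * h * τ := by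
    have : h ≤ τ := by
      have : ε * τ ≤ τ := by nlinarith
      nlinarith [mul_nonneg (by linarith : 0 ≤ K) hh]
    have : 20 * K * h * h ≤ 20 * K * h * τ := by gcongr
    nlinarith
  -- The left side is now at most (6 + 20) K h τ, which explains the constant 26000 = 26 · 1000.
  have h5 : 2 * τ * √(9 * K * d) ≤ 2 * τ * (3 * K * h) := by gcongr
  nlinarith

lemma toEuclideanLin_pow_apply {κ : Type*} [Fintype κ] [DecidableEq κ] (G : Matrix κ κ ℝ) (L : ℕ)
    (g : κ → ℝ) :
    ((Matrix.toEuclideanLin G) ^ L) (WithLp.toLp 2 g) = WithLp.toLp 2 ((G ^ L) *ᵥ g) := by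
  induction L with
  | zero => simp
  | succ L ih =>
    rw [pow_succ', Module.End.mul_apply, ih, pow_succ', ← Matrix.mulVec_mulVec]
    rfl

lemma normalizeOrFirst_dotProduct_sq {n : ℕ} {x v : Fin n → ℝ} (hx : 0 < x ⬝ᵥ x) :
    (normalizeOrFirst x ⬝ᵥ v) ^ 2 = (x ⬝ᵥ v) ^ 2 / (x ⬝ᵥ x) := by
  have : normalizeOrFirst x = (√(x ⬝ᵥ x))⁻¹ • x := by
    ext i; simp [normalizeOrFirst, hx, div_eq_inv_mul]
  rw [this, smul_dotProduct, smul_eq_mul, mul_pow, inv_pow, Real.sq_sqrt hx.le, div_eq_inv_mul]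

/-- The last step of power iteration. -/
lemma normalizeOrFirst_close {n : ℕ} {G : Matrix (Fin n) (Fin n) ℝ} {b z : Fin n → ℝ} {θ δ : ℝ}
    (h : IsSpiked (Matrix.toEuclideanLin G) (WithLp.toLp 2 b) θ δ)
    (hz : z ⬝ᵥ z < 8 * (b ⬝ᵥ z) ^ 2) :
    1 - 12 * δ ≤ (normalizeOrFirst (G *ᵥ z) ⬝ᵥ b) ^ 2 := by
  obtain ⟨h1, h2⟩ := h.apply_close (z := WithLp.toLp 2 z) (by rwa [normSq_toLp, inner_toLp_eq])
  have e : Matrix.toEuclideanLin G (WithLp.toLp 2 z) = WithLp.toLp 2 (G *ᵥ z) := rfl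
  rw [e, normSq_toLp, inner_toLp_eq] at h2
  rw [e] at h1
  have h3 : 0 < (G *ᵥ z) ⬝ᵥ (G *ᵥ z) := by rw [← normSq_toLp]; positivity
  rw [normalizeOrFirst_dotProduct_sq h3, le_div_iff₀ h3, dotProduct_comm _ b]
  exact h2

/-- A Gaussian starting vector is good for power iteration with high probability. -/
lemma measure_bad_start_le {n : ℕ} (hn : 1 ≤ n) {G : Matrix (Fin n) (Fin n) ℝ} {b : Fin n → ℝ}
    {θ δ : ℝ} (h : IsSpiked (Matrix.toEuclideanLin G) (WithLp.toLp 2 b) θ δ) :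
    Measure.pi (fun _ : Fin n => gaussianReal 0 1)
      {g | 8 * (b ⬝ᵥ ((G ^ (4 + 11 * Nat.clog 2 n)) *ᵥ g)) ^ 2 ≤
        ((G ^ (4 + 11 * Nat.clog 2 n)) *ᵥ g) ⬝ᵥ ((G ^ (4 + 11 * Nat.clog 2 n)) *ᵥ g)} ≤
      ENNReal.ofReal (1 / (n : ℝ) ^ 10) + ENNReal.ofReal (Real.exp (-n / 8)) := by
  have : Nonempty (Fin n) := ⟨⟨0, hn⟩⟩
  have hn1 : (1 : ℝ) ≤ n := by exact_mod_cast hn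
  set L := 4 + 11 * Nat.clog 2 n
  rw [pi_gaussianReal_apply]
  obtain ⟨u, hu, hpow⟩ := h.exists_power_iteration
  -- A component along u of at least n^(-10) and a norm of at most 3n/2 require 2^L ≥ 15 n^11; this
  -- is the source of the factor 11 in the iteration count.
  have h2L : 16 * (n : ℝ) ^ 11 ≤ 2 ^ L := by
    have : (n : ℝ) ≤ 2 ^ Nat.clog 2 n := by exact_mod_cast Nat.le_pow_clog one_lt_two n
    calc 16 * (n : ℝ) ^ 11 ≤ 16 * (2 ^ Nat.clog 2 n) ^ 11 := by gcongr
      _ = 2 ^ L := by rw [pow_add, mul_comm 11, pow_mul]; norm_num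
  have hsub : {x : EuclideanSpace ℝ (Fin n) | x.ofLp ∈
      {g : Fin n → ℝ | 8 * (b ⬝ᵥ ((G ^ L) *ᵥ g)) ^ 2 ≤ ((G ^ L) *ᵥ g) ⬝ᵥ ((G ^ L) *ᵥ g)}} ⊆
      {x | |inner ℝ u x| < 1 / (n : ℝ) ^ 10} ∪
        {x | (n : ℝ) + n ≤ ‖LinearMap.id (R := ℝ) x‖ ^ 2} := by
    intro x hx
    by_contra hcon
    simp only [Set.mem_union, Set.mem_ofPred_eq, not_or, not_lt, not_le, LinearMap.id_apply] at hcon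
    obtain ⟨h1, h2⟩ := hcon
    have hx0 : ‖x‖ ≤ 3 / 2 * n := by
      refine le_of_sq_le_sq ?_ (by positivity)
      nlinarith
    have hpos : (0 : ℝ) < 1 / (n : ℝ) ^ 10 := by positivity
    have h3 := hpow x L (hpos.trans_le h1) (by
      calc 10 * ‖x‖ ≤ 16 * (n : ℝ) ^ 11 * (1 / (n : ℝ) ^ 10) := by
            have : 16 * (n : ℝ) ^ 11 * (1 / (n : ℝ) ^ 10) = 16 * n := by field_simp
            rw [this]; linarith
        _ ≤ 2 ^ L * |inner ℝ u x| := by gcongr)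
    rw [show x = WithLp.toLp 2 x.ofLp from rfl, toEuclideanLin_pow_apply, normSq_toLp,
      inner_toLp_eq] at h3
    exact absurd hx (not_le.2 h3)
  refine (measure_mono hsub).trans ((measure_union_le _ _).trans (add_le_add ?_ ?_))
  · exact stdGaussian_abs_inner_lt_le hu _
  · have := stdGaussian_normSq_ge_le (LinearMap.id (R := ℝ) (M := EuclideanSpace ℝ (Fin n)))
      (EuclideanSpace.basisFun (Fin n) ℝ) (K := 1) (fun x => by simp) (l := 1 / 4) (by norm_num)
      (by norm_num) n
    have hs : ∑ i, ‖LinearMap.id (R := ℝ) (EuclideanSpace.basisFun (Fin n) ℝ i)‖ ^ 2 = (n : ℝ) := by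
      simp
    rw [hs] at this
    rw [← ofReal_measureReal]
    refine ENNReal.ofReal_le_ofReal (this.trans_eq ?_)
    congr 1; ring

/-! ### Laws of the samples and of the noise -/

lemma map_sampleLaw (n : ℕ) :
    sampleLaw.map (fun ω (i : Fin n) => ω i) = Measure.pi fun _ => gaussianReal 0 1 := by
  have h1 : iIndepFun (fun (i : ℕ) (ω : ℕ → ℝ) => ω i) sampleLaw :=
    iIndepFun_infinitePi (P := fun _ : ℕ => gaussianReal 0 1) (X := fun _ x => x)
      (fun _ => measurable_id)
  have h2 := h1.precomp (g := fun i : Fin n => (i : ℕ)) Fin.val_injective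
  have : IsProbabilityMeasure sampleLaw := by unfold sampleLaw; infer_instance
  have h3 := (iIndepFun_iff_map_fun_eq_pi_map
    (fun i : Fin n => (measurable_pi_apply (i : ℕ)).aemeasurable)).1 h2
  rw [h3]
  congr 1
  funext i
  exact Measure.infinitePi_map_eval (fun _ : ℕ => gaussianReal 0 1) (i : ℕ)

/-- The law of a tensor whose entries are copies, according to `cl`, of independent standard
Gaussians. -/
noncomputable def patternNoise {k n : ℕ} {ι : Type*} [Fintype ι] (cl : (Fin k → Fin n) → ι) :
    Measure (Tensor k n) :=
  (Measure.pi fun _ : ι => gaussianReal 0 1).map fun g α => g (cl α)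

lemma measurable_pattern {k n : ℕ} {ι : Type*} (cl : (Fin k → Fin n) → ι) :
    Measurable fun (g : ι → ℝ) (α : Fin k → Fin n) => g (cl α) := by
  fun_prop

instance isProbabilityMeasure_patternNoise {k n : ℕ} {ι : Type*} [Fintype ι]
    (cl : (Fin k → Fin n) → ι) : IsProbabilityMeasure (patternNoise cl) :=
  Measure.isProbabilityMeasure_map (measurable_pattern cl).aemeasurable

instance isProbabilityMeasure_sampleLaw : IsProbabilityMeasure sampleLaw := by
  unfold sampleLaw; infer_instance

lemma gaussianNoise_eq_patternNoise (k n : ℕ) :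
    gaussianNoise k n = patternNoise (id : (Fin k → Fin n) → (Fin k → Fin n)) := by
  rw [patternNoise, gaussianNoise]
  exact Measure.map_id.symm

lemma symmetricGaussianNoise_eq_patternNoise (k n : ℕ) :
    symmetricGaussianNoise k n = patternNoise (unordered (k := k) (n := n)) := rfl

/-- Every condition is closed in A, so the uncountable quantifier over y does no harm. -/
lemma measurableSet_nearlyIsotropic {k n : ℕ} {ρ κ : Type*} [Fintype ρ] [Fintype κ]
    (e : ρ → κ → Fin k → Fin n) (a : ρ → ℝ) (t c : ℝ) :
    MeasurableSet {A : Tensor k n | NearlyIsotropic (Matrix.of fun r j => A (e r j)) a t c} := by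
  apply IsClosed.measurableSet
  have h : ∀ y : κ → ℝ, Continuous fun A : Tensor k n => (Matrix.of fun r j => A (e r j)) *ᵥ y :=
    fun y => continuous_pi fun r => by
      simp only [Matrix.mulVec, dotProduct, Matrix.of_apply]
      fun_prop
  have h' : Continuous fun A : Tensor k n => a ᵥ* (Matrix.of fun r j => A (e r j)) :=
    continuous_pi fun j => by
      simp only [Matrix.vecMul, dotProduct, Matrix.of_apply]
      fun_prop
  simp only [NearlyIsotropic, Set.ofPred_and, Set.ofPred_forall]
  refine IsClosed.inter (isClosed_iInter fun y => isClosed_le ?_ continuous_const)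
    (isClosed_le ?_ continuous_const)
  · exact (((h y).dotProduct (h y)).sub continuous_const).abs
  · exact h'.dotProduct h'

lemma patternNoise_not_nearlyIsotropic_le {k n : ℕ} {ι ρ κ : Type*} [Fintype ι] [Fintype ρ]
    [Fintype κ] [Nonempty κ] (cl : (Fin k → Fin n) → ι) (e : ρ → κ → Fin k → Fin n)
    (hcl : ∀ a, Function.Injective fun j => cl (e a j)) {K : ℕ}
    (hK : ∀ i, Nat.card {p : ρ × κ // cl (e p.1 p.2) = i} ≤ K) (hK1 : 1 ≤ K)
    (hcard : 36 * K ^ 2 * Fintype.card κ ≤ Fintype.card ρ) {a : ρ → ℝ} (ha : a ⬝ᵥ a = 1) :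
    patternNoise cl {A | ¬ NearlyIsotropic (Matrix.of fun r j => A (e r j)) a
        (20 * K * √(Fintype.card ρ * Fintype.card κ)) (9 * K * Fintype.card κ)} ≤
      ENNReal.ofReal (3 * Real.exp (-Fintype.card κ)) := by
  refine (Measure.map_apply (measurable_pattern cl)
    (measurableSet_nearlyIsotropic e a _ _).compl).trans_le ?_
  exact measure_not_nearlyIsotropic_le (fun r j => cl (e r j)) hcl hK hK1 hcard ha

/-! ### Failure probabilities of power iteration and of exact unfolding -/

lemma rpow_quarter_pow_four (n k : ℕ) : (((n : ℝ) ^ ((k : ℝ) / 4)) ^ 4) = (n : ℝ) ^ k := by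
  rw [← Real.rpow_natCast, ← Real.rpow_mul (Nat.cast_nonneg n)]
  norm_num

/-- Power iteration recovers the spike with high probability. -/
lemma powerIteration_fail_le {k n : ℕ} (hk : 2 ≤ k) {ι : Type*} [Fintype ι]
    (cl : (Fin (k + 1) → Fin n) → ι)
    (hcl : ∀ a : Fin k → Fin n,
      Function.Injective fun j => cl (Fin.cons j a : Fin (k + 1) → Fin n)) {K : ℕ}
    (hK : ∀ i, Nat.card {p : (Fin k → Fin n) × Fin n //
      cl (Fin.cons p.2 p.1 : Fin (k + 1) → Fin n) = i} ≤ K) (hK1 : 1 ≤ K)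
    (hn : 36 * K ^ 2 ≤ n) {v₀ : Fin n → ℝ} (hv : v₀ ⬝ᵥ v₀ = 1) {ε τ : ℝ} (hε0 : 0 < ε)
    (hε : ε ≤ 1) (hτ : 26000 * K * (n : ℝ) ^ (((k + 1 : ℕ) : ℝ) / 4) ≤ ε * τ) :
    ((patternNoise cl).prod sampleLaw)
      {x | ¬ 1 - 12 * (ε / 1000) ≤
        ((Program.powerIteration k).output (spiked τ v₀ x.1) x.2 ⬝ᵥ v₀) ^ 2} ≤
      ENNReal.ofReal (3 * Real.exp (-n)) +
        (ENNReal.ofReal (1 / (n : ℝ) ^ 10) + ENNReal.ofReal (Real.exp (-n / 8))) := by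
  have hn1 : 1 ≤ n := le_trans (by nlinarith [Nat.pos_of_ne_zero (by omega : K ≠ 0)]) hn
  have : Nonempty (Fin n) := ⟨⟨0, hn1⟩⟩
  have hn1' : (1 : ℝ) ≤ n := by exact_mod_cast hn1
  have hK1' : (1 : ℝ) ≤ K := by exact_mod_cast hK1
  set h := (n : ℝ) ^ (((k + 1 : ℕ) : ℝ) / 4) with hh
  have hh0 : 0 < h := Real.rpow_pos_of_pos (by linarith) _
  have hτ0 : 0 < τ := by
    have : 0 < ε * τ := lt_of_lt_of_le (by positivity) hτ
    exact pos_of_mul_pos_right this hε0.le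
  have hpow : n * n ≤ n ^ k := by
    rw [← sq]; exact Nat.pow_le_pow_right hn1 hk
  have hN : (Fintype.card (Fin k → Fin n) : ℝ) = (n : ℝ) ^ k := by simp
  have hd : (Fintype.card (Fin n) : ℝ) = n := by simp
  set a := tensorPower k v₀
  have ha : a ⬝ᵥ a = 1 := tensorPower_dotProduct_self k hv
  set t := 20 * (K : ℝ) * √(Fintype.card (Fin k → Fin n) * Fintype.card (Fin n))
  set c := 9 * (K : ℝ) * Fintype.card (Fin n)
  set e : (Fin k → Fin n) → Fin n → Fin (k + 1) → Fin n := fun a j => Fin.cons j a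
  set Good : Set (Tensor (k + 1) n) := {A | NearlyIsotropic (Matrix.of fun r j => A (e r j)) a t c}
  have hGoodm : MeasurableSet Good := measurableSet_nearlyIsotropic e a t c
  have hGood : patternNoise cl Goodᶜ ≤ ENNReal.ofReal (3 * Real.exp (-n)) := by
    have := patternNoise_not_nearlyIsotropic_le cl e hcl hK hK1 (by simp; nlinarith) ha
    exact this.trans_eq (by rw [hd])
  have hspiked : ∀ A ∈ Good, IsSpiked (Matrix.toEuclideanLin
      (centredGram (firstUnfolding (spiked τ v₀ A)))) (WithLp.toLp 2 v₀) (τ ^ 2) (ε / 1000) := by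
    intro A hA
    rw [firstUnfolding_spiked]
    refine isSpiked_centredGram hA ha hv hτ0 (by positivity) (by linarith)
      (noise_le_signal hK1' ?_ ?_ hh0.le ?_ hε hτ hτ0)
    · rw [hd]; exact hn1'
    · rw [hd, hN]; exact_mod_cast le_trans (by nlinarith) hpow
    · rw [hd, hN, hh, rpow_quarter_pow_four, pow_succ]
  set L := 4 + 11 * Nat.clog 2 n with hL
  set z : Tensor (k + 1) n × (ℕ → ℝ) → Fin n → ℝ := fun x =>
    (centredGram (firstUnfolding (spiked τ v₀ x.1)) ^ L) *ᵥ fun i : Fin n => x.2 i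
  have hzc : Continuous z := by
    have h1 : Continuous fun x : Tensor (k + 1) n × (ℕ → ℝ) =>
        firstUnfolding (spiked τ v₀ x.1) := by
      refine continuous_matrix fun r j => ?_
      simp only [firstUnfolding, spiked, Matrix.of_apply]
      fun_prop
    have h2 : Continuous fun x : Tensor (k + 1) n × (ℕ → ℝ) =>
        centredGram (firstUnfolding (spiked τ v₀ x.1)) :=
      (h1.matrix_transpose.matrix_mul h1).sub continuous_const
    exact (h2.pow L).matrix_mulVec (by fun_prop)
  set Bad : Set (Tensor (k + 1) n × (ℕ → ℝ)) := {x | 8 * (v₀ ⬝ᵥ z x) ^ 2 ≤ z x ⬝ᵥ z x}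
  have hBadm : MeasurableSet Bad :=
    (isClosed_le (((continuous_const.dotProduct hzc).pow 2).const_mul 8)
      (hzc.dotProduct hzc)).measurableSet
  -- Either the noise is bad, or the noise is good and the start is bad. In the second case Fubini
  -- fixes A, and hence G and its top eigenvector, before the independent start is drawn. One of the
  -- L + 1 applications of G is kept for the final accuracy.
  have hsub : {x : Tensor (k + 1) n × (ℕ → ℝ) | ¬ 1 - 12 * (ε / 1000) ≤
        ((Program.powerIteration k).output (spiked τ v₀ x.1) x.2 ⬝ᵥ v₀) ^ 2} ⊆
      (Goodᶜ ×ˢ Set.univ) ∪ ((Good ×ˢ Set.univ) ∩ Bad) := by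
    intro x hx
    by_contra hcon
    apply hx
    simp only [Set.mem_union, Set.mem_prod, Set.mem_compl_iff, Set.mem_univ, and_true,
      Set.mem_inter_iff, not_or, not_not, not_and] at hcon
    obtain ⟨h1, h2⟩ := hcon
    rw [(Program.run_powerIteration k _ _).1, iterationCount,
      show 5 + 11 * Nat.clog 2 n = L + 1 by omega, pow_succ' (centredGram _) L,
      ← Matrix.mulVec_mulVec]
    exact normalizeOrFirst_close (hspiked x.1 h1) (not_le.1 (h2 h1))
  refine (measure_mono hsub).trans ((measure_union_le _ _).trans (add_le_add ?_ ?_))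
  · rw [Measure.prod_prod, measure_univ, mul_one]
    exact hGood
  · rw [Measure.prod_apply ((hGoodm.prod MeasurableSet.univ).inter hBadm)]
    set q := ENNReal.ofReal (1 / (n : ℝ) ^ 10) + ENNReal.ofReal (Real.exp (-n / 8))
    calc _ ≤ ∫⁻ _, q ∂(patternNoise cl) := by
          refine lintegral_mono fun A => ?_
          by_cases hA : A ∈ Good
          · refine le_trans ?_ (measure_bad_start_le hn1 (hspiked A hA))
            rw [← map_sampleLaw n]
            refine (measure_mono fun ω hω => ?_).trans (Measure.le_map_apply
              (measurable_pi_lambda _ fun i => measurable_pi_apply _).aemeasurable _)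
            exact hω.2
          · have : Prod.mk A ⁻¹' ((Good ×ˢ Set.univ) ∩ Bad) = ∅ := by
              ext ω; simp [hA]
            rw [this]; simp
      _ = q := by simp

/-- Exact tensor unfolding recovers the spike from asymmetric noise with high probability. -/
lemma unfolding_fail_le {n m : ℕ} (hn : 36 ≤ n) {v₀ : Fin n → ℝ} (hv : v₀ ⬝ᵥ v₀ = 1) {ε τ : ℝ}
    (hε0 : 0 < ε) (hε : ε ≤ 1)
    (hτ : 26000 * (n : ℝ) ^ (((m + 2 + (m + 1) : ℕ) : ℝ) / 4) ≤ ε * τ) :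
    gaussianNoise (m + 2 + (m + 1)) n
      {A | ¬ ∀ w : Fin n → ℝ, IsUnfoldingOutput (spiked τ v₀ A) w →
        1 - 12 * (ε / 1000) ≤ (w ⬝ᵥ v₀) ^ 2} ≤ ENNReal.ofReal (3 * Real.exp (-n)) := by
  have hn1 : 1 ≤ n := by omega
  have : Nonempty (Fin n) := ⟨⟨0, hn1⟩⟩
  have hn1' : (1 : ℝ) ≤ n := by exact_mod_cast hn1
  set h := (n : ℝ) ^ (((m + 2 + (m + 1) : ℕ) : ℝ) / 4) with hh
  have hh0 : 0 < h := Real.rpow_pos_of_pos (by linarith) _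
  have hτ0 : 0 < τ := by
    have : 0 < ε * τ := lt_of_lt_of_le (by positivity) hτ
    exact pos_of_mul_pos_right this hε0.le
  set a := tensorPower (m + 2) v₀
  set b := tensorPower (m + 1) v₀
  have ha : a ⬝ᵥ a = 1 := tensorPower_dotProduct_self _ hv
  have hb : b ⬝ᵥ b = 1 := tensorPower_dotProduct_self _ hv
  set e : (Fin (m + 2) → Fin n) → (Fin (m + 1) → Fin n) → Fin (m + 2 + (m + 1)) → Fin n :=
    fun α β => Fin.append α β
  have hN : (Fintype.card (Fin (m + 2) → Fin n) : ℝ) = (n : ℝ) ^ (m + 2) := by simp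
  have hd : (Fintype.card (Fin (m + 1) → Fin n) : ℝ) = (n : ℝ) ^ (m + 1) := by simp
  have heinj : ∀ p p' : (Fin (m + 2) → Fin n) × (Fin (m + 1) → Fin n),
      e p.1 p.2 = e p'.1 p'.2 → p = p' := fun p p' hp =>
    (Fin.appendEquiv (α := Fin n) (m + 2) (m + 1)).injective hp
  have hiso := patternNoise_not_nearlyIsotropic_le (K := 1)
    (id : (Fin (m + 2 + (m + 1)) → Fin n) → _) e
    (fun α β β' hβ => (Prod.ext_iff.1 (heinj (α, β) (α, β') hβ)).2)
    (fun i => by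
      rw [Finite.card_le_one_iff_subsingleton]
      exact ⟨fun p p' => Subtype.ext (heinj _ _ (p.2.trans p'.2.symm))⟩) le_rfl
    (by
      simp only [Fintype.card_pi, Fintype.card_fin, Finset.prod_const, Finset.card_univ, one_pow,
        mul_one]
      rw [pow_succ n (m + 1), mul_comm]
      gcongr) ha
  rw [gaussianNoise_eq_patternNoise]
  refine (measure_mono ?_).trans (hiso.trans (ENNReal.ofReal_le_ofReal ?_))
  · intro A hA hiso
    apply hA
    rintro w ⟨m', hm', u, hu, hw⟩
    obtain rfl : m' = m := by omega
    have hsp := isSpiked_centredGram (δ := ε / 1000) hiso ha hb hτ0 (by positivity) (by linarith)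
      (noise_le_signal (h := h) (by simp) ?_ ?_ hh0.le ?_ hε (by simpa using hτ) hτ0)
    · rw [unfold_spiked] at hu
      exact reshape_close hv hu.1 (by positivity) (by linarith) (hu.one_sub_sq_le hb hsp) hw
    · rw [hd]; exact one_le_pow₀ hn1'
    · rw [hd, hN]; exact pow_le_pow_right₀ hn1' (by omega)
    · rw [hd, hN, hh, rpow_quarter_pow_four, pow_add]
  · have : (n : ℝ) ≤ Fintype.card (Fin (m + 1) → Fin n) := by
      rw [hd]
      exact le_self_pow₀ hn1' (by omega)
    gcongr

/-! ### Repeated entries of symmetric tensors -/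

/-- Removing the entries of a from the multiset leaves j, so a row of the thin unfolding has no
repeated Gaussian. Wider unfoldings fail here, since permuting a column multi-index repeats an
entry. -/
lemma unordered_cons_injective {k n : ℕ} (a : Fin k → Fin n) :
    Function.Injective fun j => unordered (Fin.cons j a : Fin (k + 1) → Fin n) := by
  intro j j' h
  have h1 := congrArg Subtype.val h
  simp only [unordered, Fin.univ_val_map, List.ofFn_succ, Fin.cons_zero, Fin.cons_succ,
    ← Multiset.cons_coe] at h1
  exact (Multiset.cons_inj_left _).1 h1

/-- A multi-index in the fibre takes its values in the support of `i`, which has at most k + 1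
elements. -/
lemma card_unordered_fiber_le {k n : ℕ} (i : Sym (Fin n) (k + 1)) :
    Nat.card {p : (Fin k → Fin n) × Fin n //
      unordered (Fin.cons p.2 p.1 : Fin (k + 1) → Fin n) = i} ≤ (k + 1) ^ (k + 1) := by
  classical
  rw [Nat.card_eq_fintype_card, Fintype.card_subtype]
  set S := Fintype.piFinset fun _ : Fin (k + 1) => (i : Multiset (Fin n)).toFinset
  have hS : S.card ≤ (k + 1) ^ (k + 1) := by
    rw [Fintype.card_piFinset_const]
    have : (i : Multiset (Fin n)).toFinset.card ≤ k + 1 :=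
      (Multiset.toFinset_card_le _).trans_eq i.2
    simpa using Nat.pow_le_pow_left this (k + 1)
  refine le_trans (Finset.card_le_card_of_injOn
    (fun p : (Fin k → Fin n) × Fin n => (Fin.cons p.2 p.1 : Fin (k + 1) → Fin n)) ?_ ?_) hS
  · intro p hp
    simp only [Finset.coe_filter, Finset.mem_univ, true_and, Set.mem_ofPred_eq] at hp
    simp only [S, Finset.mem_coe, Fintype.mem_piFinset, Multiset.mem_toFinset]
    intro l
    rw [← hp]
    exact Multiset.mem_map_of_mem _ (Finset.mem_univ_val l)
  · intro p _ p' _ h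
    have := Fin.cons_inj.1 h
    exact Prod.ext this.2 this.1

/-! ### Polynomial bounds for the failure probability -/

lemma exp_neg_div_eight_le {n : ℕ} (hn : 1 ≤ n) :
    Real.exp (-n / 8) ≤ 8 ^ 10 * (Nat.factorial 10) / (n : ℝ) ^ 10 := by
  have hn0 : (0 : ℝ) < n := by exact_mod_cast hn
  have h := Real.pow_div_factorial_le_exp ((n : ℝ) / 8) (by positivity) 10
  rw [neg_div, Real.exp_neg, inv_le_comm₀ (Real.exp_pos _) (by positivity)]
  refine le_trans (le_of_eq ?_) h
  rw [inv_div, div_pow]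
  field_simp

lemma failure_probability_le {n : ℕ} (hn : 1 ≤ n) {C : ℝ}
    (hC : 7 * (8 ^ 10 * (Nat.factorial 10 : ℝ)) + 1 ≤ C) :
    ENNReal.ofReal (3 * Real.exp (-n)) +
        (ENNReal.ofReal (1 / (n : ℝ) ^ 10) + ENNReal.ofReal (Real.exp (-n / 8))) +
      ENNReal.ofReal (3 * Real.exp (-n)) ≤ ENNReal.ofReal (C / (n : ℝ) ^ 10) := by
  have hn0 : (0 : ℝ) < n := by exact_mod_cast hn
  rw [← ENNReal.ofReal_add (by positivity) (by positivity),
    ← ENNReal.ofReal_add (by positivity) (by positivity),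
    ← ENNReal.ofReal_add (by positivity) (by positivity)]
  apply ENNReal.ofReal_le_ofReal
  have h1 := exp_neg_div_eight_le hn
  have h2 : Real.exp (-n) ≤ Real.exp (-n / 8) := Real.exp_le_exp.2 (by linarith)
  have h3 : (7 * (8 ^ 10 * (Nat.factorial 10 : ℝ)) + 1) / (n : ℝ) ^ 10 ≤ C / (n : ℝ) ^ 10 := by
    gcongr
  have h4 : (7 * (8 ^ 10 * (Nat.factorial 10 : ℝ)) + 1) / (n : ℝ) ^ 10 =
      7 * (8 ^ 10 * (Nat.factorial 10) / (n : ℝ) ^ 10) + 1 / (n : ℝ) ^ 10 := by ring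
  linarith

/-- For small n the claimed probability bound is vacuous; this disposes of the dimensions in which
the concentration estimate does not apply. -/
lemma one_le_bound_of_lt {n N : ℕ} (hn : 1 ≤ n) (h : n ≤ N) {C : ℝ} (hC : (N : ℝ) ^ 10 ≤ C) :
    1 ≤ ENNReal.ofReal (C / (n : ℝ) ^ 10) := by
  have hn0 : (0 : ℝ) < n := by exact_mod_cast hn
  have : (n : ℝ) ^ 10 ≤ N ^ 10 := by gcongr
  rw [← ENNReal.ofReal_one]
  apply ENNReal.ofReal_le_ofReal
  rw [le_div_iff₀ (by positivity), one_mul]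
  linarith

end TensorPCA

/-! ### Assembly for the two noise models -/

open TensorPCA
theorem mainTheorem11 (k : ℕ) (hk : Odd k) (hk3 : 3 ≤ k) :
    (∃ P : Program, P.NearlyLinearTime k ∧ ∃ C : ℝ, 0 < C ∧
      ∀ (n : ℕ) (v₀ : Fin n → ℝ) (ε τ : ℝ), v₀ ⬝ᵥ v₀ = 1 → 0 < ε →
        C * (n : ℝ) ^ ((k : ℝ) / 4) / ε ≤ τ →
        ((gaussianNoise k n).prod sampleLaw)
          {x | ¬ (Recovers ε v₀ (P.output (spiked τ v₀ x.1) x.2) ∧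
            ∀ w : Fin n → ℝ, IsUnfoldingOutput (spiked τ v₀ x.1) w →
              Recovers ε v₀ w ∧ Recovers ε w (P.output (spiked τ v₀ x.1) x.2))}
          ≤ ENNReal.ofReal (C / (n : ℝ) ^ 10)) ∧
    (∃ P : Program, P.NearlyLinearTime k ∧ ∃ C : ℝ, 0 < C ∧
      ∀ (n : ℕ) (v₀ : Fin n → ℝ) (ε τ : ℝ), v₀ ⬝ᵥ v₀ = 1 → 0 < ε →
        C * (n : ℝ) ^ ((k : ℝ) / 4) / ε ≤ τ →
        ((symmetricGaussianNoise k n).prod sampleLaw)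
          {x | ¬ Recovers ε v₀ (P.output (spiked τ v₀ x.1) x.2)}
          ≤ ENNReal.ofReal (C / (n : ℝ) ^ 10)) := by
  -- With k = 2m + 3, the thin unfolding has row exponent k − 1 = m + 2 + m, and m + 2 + (m + 1) is
  -- definitionally its successor.
  obtain ⟨m, rfl⟩ : ∃ m, k = m + 2 + (m + 1) := by
    obtain ⟨r, rfl⟩ := hk
    exact ⟨r - 1, by omega⟩
  have hpos : ∀ {n : ℕ} {v : Fin n → ℝ}, v ⬝ᵥ v = 1 → 1 ≤ n := fun {n v} hv => by
    rcases Nat.eq_zero_or_pos n with rfl | h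
    · simp at hv
    · exact h
  have hunit : ∀ {n : ℕ} (T : Tensor (m + 2 + m + 1) n) (ω : ℕ → ℝ), 1 ≤ n →
      (Program.powerIteration (m + 2 + m)).output T ω ⬝ᵥ
        (Program.powerIteration (m + 2 + m)).output T ω = 1 := fun T ω hn => by
    rw [(Program.run_powerIteration _ T ω).1]
    exact normalizeOrFirst_dotProduct_self hn _
  set F : ℝ := 7 * (8 ^ 10 * (Nat.factorial 10 : ℝ)) + 1 with hF
  -- The three summands of each constant serve the signal threshold, the trivial bound for small n,
  -- and the failure probability for large n.
  refine ⟨⟨Program.powerIteration (m + 2 + m), nearlyLinearTime_powerIteration _,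
    26000 + (36 : ℕ) ^ 10 + F, by positivity, ?_⟩,
    ⟨Program.powerIteration (m + 2 + m), nearlyLinearTime_powerIteration _,
    26000 * ((m + 2 + m + 1) ^ (m + 2 + m + 1) : ℕ) +
      (36 * ((m + 2 + m + 1) ^ (m + 2 + m + 1)) ^ 2 : ℕ) ^ 10 + F, by positivity, ?_⟩⟩
  · intro n v₀ ε τ hv hε hτ
    have hn := hpos hv
    have hF0 : 0 < F := by positivity
    rw [gaussianNoise_eq_patternNoise]
    rcases lt_or_ge n 36 with hn36 | hn36
    · exact prob_le_one.trans (one_le_bound_of_lt hn hn36.le (by linarith))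
    -- For ε > 1 the correlation bounds are vacuous, and only unit length is needed; it holds for
    -- every input and sample stream.
    rcases lt_or_ge 1 ε with hε1 | hε1
    · refine le_trans (measure_mono (t := ∅) ?_) (measure_empty.trans_le zero_le)
      refine fun x hx => hx ?_
      refine ⟨⟨hunit _ _ hn, ?_⟩, fun w hw => ⟨⟨?_, ?_⟩, hunit _ _ hn, ?_⟩⟩
      · nlinarith
      · obtain ⟨_, _, _, _, hw⟩ := hw
        exact hw.1
      · nlinarith
      · nlinarith
    set h := (n : ℝ) ^ (((m + 2 + (m + 1) : ℕ) : ℝ) / 4) with hh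
    have hh0 : 0 < h := Real.rpow_pos_of_pos (by exact_mod_cast hn) _
    have hτ' : 26000 * h ≤ ε * τ := by
      rw [div_le_iff₀ hε] at hτ
      refine le_trans ?_ (hτ.trans_eq (mul_comm _ _))
      gcongr
      have : (0 : ℝ) ≤ (36 : ℕ) ^ 10 := by positivity
      linarith
    have h1 := powerIteration_fail_le (k := m + 2 + m) (K := 1) (by omega)
      (id : (Fin (m + 2 + m + 1) → Fin n) → _)
      (fun a j j' hj => (Fin.cons_inj.1 hj).1)
      (fun i => by
        rw [Finite.card_le_one_iff_subsingleton]
        refine ⟨fun p p' => Subtype.ext ?_⟩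
        have := Fin.cons_inj.1 (p.2.trans p'.2.symm)
        exact Prod.ext this.2 this.1) le_rfl (by simpa using hn36) hv hε hε1
      (τ := τ) (by rw [Nat.cast_one, mul_one]; exact hτ')
    have h2 := unfolding_fail_le (m := m) hn36 hv hε hε1 hτ'
    rw [gaussianNoise_eq_patternNoise] at h2
    refine le_trans ?_ (failure_probability_le hn (C := 26000 + (36 : ℕ) ^ 10 + F)
      (by rw [← hF]; have : (0 : ℝ) ≤ (36 : ℕ) ^ 10 := by positivity
          linarith))
    have hU : ((patternNoise id).prod sampleLaw)
        ({A : Tensor (m + 2 + (m + 1)) n | ¬ ∀ w : Fin n → ℝ,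
          IsUnfoldingOutput (spiked τ v₀ A) w → 1 - 12 * (ε / 1000) ≤ (w ⬝ᵥ v₀) ^ 2} ×ˢ
            (Set.univ : Set (ℕ → ℝ))) ≤ ENNReal.ofReal (3 * Real.exp (-n)) := by
      rw [Measure.prod_prod, measure_univ, mul_one]
      exact h2
    refine le_trans (measure_mono ?_) ((measure_union_le _ _).trans (add_le_add h1 hU))
    · intro x hx
      by_contra hcon
      apply hx
      simp only [Set.mem_union, Set.mem_prod, Set.mem_univ, and_true, Set.mem_ofPred_eq, not_or,
        not_not] at hcon
      obtain ⟨c1, c2⟩ := hcon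
      replace c1 := not_not.1 c1
      have u0 := hunit (spiked τ v₀ x.1) x.2 hn
      refine ⟨⟨u0, by linarith⟩, fun w hw => ?_⟩
      have hw1 : w ⬝ᵥ w = 1 := by
        obtain ⟨_, _, _, _, hw⟩ := hw
        exact hw.1
      have c3 := c2 w hw
      refine ⟨⟨hw1, by linarith⟩, u0, ?_⟩
      -- Both vectors have error η = 12 ε/1000 with respect to v₀, so their mutual error is at most
      -- 4η = 48 ε/1000 ≤ ε.
      have := one_sub_le_inner_sq_of_close (norm_toLp_eq_one u0) (norm_toLp_eq_one hw1)
        (norm_toLp_eq_one hv) (η := 12 * (ε / 1000))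
        (by rw [inner_toLp_eq, dotProduct_comm]; exact c1)
        (by rw [inner_toLp_eq, dotProduct_comm]; exact c3) (by positivity) (by linarith)
      rw [inner_toLp_eq] at this
      refine le_trans ?_ this
      linarith
  · intro n v₀ ε τ hv hε hτ
    have hn := hpos hv
    have hF0 : 0 < F := by positivity
    rw [symmetricGaussianNoise_eq_patternNoise]
    set K : ℕ := (m + 2 + m + 1) ^ (m + 2 + m + 1) with hK
    have hK1 : 1 ≤ K := Nat.one_le_pow _ _ (by omega)
    have hK0 : (0 : ℝ) ≤ (36 * K ^ 2 : ℕ) ^ 10 := by positivity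
    rcases lt_or_ge n (36 * K ^ 2) with hnK | hnK
    · refine prob_le_one.trans (one_le_bound_of_lt hn hnK.le ?_)
      have : (0 : ℝ) ≤ 26000 * K := by positivity
      linarith
    rcases lt_or_ge 1 ε with hε1 | hε1
    · refine le_trans (measure_mono (t := ∅) ?_) (measure_empty.trans_le zero_le)
      exact fun x hx => hx ⟨hunit _ _ hn, by nlinarith⟩
    have hτ' : 26000 * K * (n : ℝ) ^ (((m + 2 + (m + 1) : ℕ) : ℝ) / 4) ≤ ε * τ := by
      rw [div_le_iff₀ hε] at hτ
      refine le_trans ?_ (hτ.trans_eq (mul_comm _ _))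
      have : 0 ≤ (n : ℝ) ^ (((m + 2 + (m + 1) : ℕ) : ℝ) / 4) := by positivity
      gcongr
      linarith
    have h1 := powerIteration_fail_le (k := m + 2 + m) (K := K) (by omega)
      (unordered (k := m + 2 + m + 1) (n := n)) unordered_cons_injective card_unordered_fiber_le
      hK1 hnK hv hε hε1 hτ'
    refine le_trans (measure_mono ?_) ((h1.trans le_self_add).trans (failure_probability_le hn
      (by rw [← hF]; have : (0 : ℝ) ≤ 26000 * K := by positivity
          linarith)))
    intro x hx hcon
    exact hx ⟨hunit _ _ hn, by linarith⟩
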